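/- Consider labeled chip-firing on the line $\mathbb{Z}$ with one self-loop at each vertex: finitely many labeled chips sit at integer sites, and a firing move chooses three distinct chips at a common site, sends one with the smallest label among the three one site to the left and one with the largest label one site to the right, and leaves the third where it is (among chips with equal labels, any one may be treated as the smaller). A configuration is final if no firing move is possible, that is, if no site holds three or more chips. A set of chips is weakly sorted in a configuration if no chip of the set is strictly to the right of a chip of the set with a larger label; a configuration is weakly sorted if the set of all its chips is. Let $n = 4m+1 > 1$, and let $n$ chips start at the origin. (1) If the chips are labeled $1, 2, \dots, n$, then there is a finite firing sequence that ends in a final configuration that is not weakly sorted. (2) Label the chips instead with two chips for each of the labels $-m,\dots,-1,1,\dots,m$ and one chip labeled $0$. Then there is a finite firing sequence ending in a final configuration that is not weakly sorted and that is of the following form: first the two chips labeled $-m$ are held at the origin and the other $4m-1$ chips are fired among themselves until no further move among them is possible; then arbitrary moves are made until the configuration is final. (3) Moreover, for the labels of (2) and whatever moves are chosen: at the end of every first phase of this form, the $4m-1$ chips not labeled $-m$ are weakly sorted, and every final configuration reached from there is not weakly sorted. -/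

import Mathlib

/-! Labeled chip-firing on the line `ℤ` with one self-loop at every vertex. -/

namespace SelfLoopChips

/-- A configuration of `n` chips on the line: chip `i` is at site `x i`. -/
abbrev Config (n : ℕ) : Type := Fin n → ℤ

/-- The initial configuration: all chips are at the origin. -/
def allAtOrigin (n : ℕ) : Config n := fun _ => 0

/-- One firing move that uses only chips from the set `S`, where chip `i` carries the label
`lab i`: three distinct chips `a`, `b`, `c` at a common site are chosen, with
`lab a ≤ lab b ≤ lab c`; the smallest, `a`, moves one site to the left, the largest, `c`, moves one
site to the right, and `b` stays (it goes around the self-loop). Among chips with equal labels,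
any of them may be treated as the smaller one. -/
def FiresIn {n : ℕ} (lab : Fin n → ℤ) (S : Set (Fin n)) (x y : Config n) : Prop :=
  ∃ a ∈ S, ∃ b ∈ S, ∃ c ∈ S,
    a ≠ b ∧ b ≠ c ∧ a ≠ c ∧ x a = x b ∧ x b = x c ∧ lab a ≤ lab b ∧ lab b ≤ lab c ∧
      y = Function.update (Function.update x a (x a - 1)) c (x c + 1)

/-- `y` is obtained from `x` by a finite sequence of firing moves that use only chips from `S`. -/
def ReachesIn {n : ℕ} (lab : Fin n → ℤ) (S : Set (Fin n)) : Config n → Config n → Prop :=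
  Relation.ReflTransGen (FiresIn lab S)

/-- No firing move that uses only chips from `S` is available at `x`. -/
def FinalIn {n : ℕ} (lab : Fin n → ℤ) (S : Set (Fin n)) (x : Config n) : Prop :=
  ∀ y, ¬ FiresIn lab S x y

/-- The chips from `S` are in weakly sorted order: a chip with a smaller label is never strictly
to the right of a chip with a larger label. -/
def WeaklySortedOn {n : ℕ} (lab : Fin n → ℤ) (S : Set (Fin n)) (x : Config n) : Prop :=
  ∀ a ∈ S, ∀ b ∈ S, lab a < lab b → x a ≤ x b

/-- `y` is obtained from `x` by a finite sequence of arbitrary firing moves. -/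
def Reaches {n : ℕ} (lab : Fin n → ℤ) (x y : Config n) : Prop := ReachesIn lab Set.univ x y

/-- No firing move is available at `x`. -/
def Final {n : ℕ} (lab : Fin n → ℤ) (x : Config n) : Prop := FinalIn lab Set.univ x

/-- The configuration `x` is weakly sorted. -/
def WeaklySorted {n : ℕ} (lab : Fin n → ℤ) (x : Config n) : Prop := WeaklySortedOn lab Set.univ x

/-- The labels `1, 2, …, n`. -/
def distinctLabel (n : ℕ) (i : Fin n) : ℤ := (i : ℤ) + 1

/-- The labels `-m, -m, …, -1, -1, 0, 1, 1, …, m, m` of `4 * m + 1` chips, in this order. -/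
def doubleLabel (m : ℕ) (i : Fin (4 * m + 1)) : ℤ :=
  if (i : ℕ) < 2 * m then (((i : ℕ) / 2 : ℕ) : ℤ) - m else ((((i : ℕ) + 1) / 2 : ℕ) : ℤ) - m

/-- The chips that are not labeled `-m`: all but the two chips with the smallest label. -/
def unheld (m : ℕ) : Set (Fin (4 * m + 1)) := {i | doubleLabel m i ≠ -(m : ℤ)}

end SelfLoopChips

/-! Non-sortedness and the sortedness of the first phase have separate proofs.

Non-sortedness is short. All `4m+1` chips stay in `[-m, m]` (`Reaches.abs_le`), so the site `-m`
never fires and a chip that arrives there stays. The `4m-1` unheld chips always end with one chip at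
each of `-m`, `0`, `m` and two at every other site of the interval, so some unheld chip ends at
`-m`. In a weakly sorted final configuration both held chips would have to be there too, and three
chips at one site can fire. Distinct labels refine the double labels, which gives (1).

For sortedness, cut the labels at a threshold into small chips `Z` and large chips `O`. The total
excess at `p` grows by one exactly when `p` fires, so the number of firings of `p` still to come,
`remaining`, is determined by the configuration; it starts at `(m-|p|)^2`. The last `m-|p|` firings
of the sites are ordered in a forced way relative to those of their neighbours
(`remaining_neighbour`). Firings outside this tail can therefore be commuted to the front, and the
tail can be arranged in `m` left-to-right sweeps, each of whose firings finds exactly three chips.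
Once a sweep meets a chip of `O`, it carries one along to the right.

An obstacle argument bounds the excess of `Z` before the sweeps by a quarter square, and every sweep
lowers the argument of that quarter square by one (`SweepBound.succ`). If `|O|` is `2j-1` or `2j`,
the bound vanishes at `m-j` after `j` sweeps, so `Z` ends weakly to the left of `m-j`
(`le_of_final`). If `|O| = 2j`, one further sweep puts `O` weakly to the right of it
(`ge_of_final`). Reflection treats the nonpositive thresholds. -/

namespace SelfLoopChips

/-! ### Excess as a potential: its first differences count chips to the right, its second
differences chips at a site. -/

section Potential

variable {ι : Type*}

/-- The total distance by which the chips of `A` lie to the right of the site `t`. -/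
def excess (A : Finset ι) (t : ℤ) (x : ι → ℤ) : ℤ := ∑ i ∈ A, max (x i - t) 0

/-- The number of chips of `A` strictly to the right of `t`. -/
def rightCount (A : Finset ι) (t : ℤ) (x : ι → ℤ) : ℤ := (A.filter fun i => t < x i).card

/-- The number of chips of `A` at the site `p`. -/
def siteCount (A : Finset ι) (p : ℤ) (x : ι → ℤ) : ℤ := (A.filter fun i => x i = p).card

theorem rightCount_eq (A : Finset ι) (t : ℤ) (x : ι → ℤ) :
    rightCount A t x = excess A t x - excess A (t + 1) x := by
  unfold rightCount excess
  rw [Finset.card_filter, ← Finset.sum_sub_distrib]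
  push_cast
  refine Finset.sum_congr rfl fun i _ => ?_
  split_ifs <;> omega

theorem siteCount_eq (A : Finset ι) (p : ℤ) (x : ι → ℤ) :
    siteCount A p x = excess A (p - 1) x + excess A (p + 1) x - 2 * excess A p x := by
  unfold siteCount excess
  rw [Finset.card_filter, Finset.mul_sum, ← Finset.sum_add_distrib, ← Finset.sum_sub_distrib]
  push_cast
  refine Finset.sum_congr rfl fun i _ => ?_
  split_ifs <;> omega

theorem siteCount_nonneg (A : Finset ι) (p : ℤ) (x : ι → ℤ) : 0 ≤ siteCount A p x :=
  Int.natCast_nonneg _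

theorem rightCount_nonneg (A : Finset ι) (t : ℤ) (x : ι → ℤ) : 0 ≤ rightCount A t x :=
  Int.natCast_nonneg _

theorem excess_nonneg (A : Finset ι) (t : ℤ) (x : ι → ℤ) : 0 ≤ excess A t x :=
  Finset.sum_nonneg fun _ _ => le_max_right _ _

theorem rightCount_le_card (A : Finset ι) (t : ℤ) (x : ι → ℤ) : rightCount A t x ≤ A.card := by
  unfold rightCount
  exact_mod_cast Finset.card_filter_le _ _

theorem rightCount_anti (A : Finset ι) (x : ι → ℤ) {s t : ℤ} (h : s ≤ t) :
    rightCount A t x ≤ rightCount A s x := by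
  unfold rightCount
  have : (A.filter fun i => t < x i) ⊆ (A.filter fun i => s < x i) := by
    intro i hi
    simp only [Finset.mem_filter] at hi ⊢
    exact ⟨hi.1, by omega⟩
  exact_mod_cast Finset.card_le_card this

theorem excess_eq_zero_iff (A : Finset ι) (t : ℤ) (x : ι → ℤ) :
    excess A t x = 0 ↔ ∀ i ∈ A, x i ≤ t := by
  unfold excess
  rw [Finset.sum_eq_zero_iff_of_nonneg fun _ _ => le_max_right _ _]
  refine forall₂_congr fun i _ => ?_
  omega

theorem excess_zero (A : Finset ι) (t : ℤ) :
    excess A t (0 : ι → ℤ) = A.card * max (-t) 0 := by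
  simp [excess]

theorem one_le_siteCount {A : Finset ι} {p : ℤ} {x : ι → ℤ} {i : ι} (hi : i ∈ A) (h : x i = p) :
    1 ≤ siteCount A p x := by
  unfold siteCount
  have : 0 < (A.filter fun i => x i = p).card :=
    Finset.card_pos.mpr ⟨i, by simp [hi, h]⟩
  omega

theorem three_le_siteCount [DecidableEq ι] {A : Finset ι} {p : ℤ} {x : ι → ℤ} {a b c : ι}
    (ha : a ∈ A) (hb : b ∈ A) (hc : c ∈ A) (hab : a ≠ b) (hbc : b ≠ c) (hac : a ≠ c)
    (hxa : x a = p) (hxb : x b = p) (hxc : x c = p) : 3 ≤ siteCount A p x := by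
  unfold siteCount
  have h : ({a, b, c} : Finset ι) ⊆ A.filter fun i => x i = p := by
    intro i hi
    simp only [Finset.mem_insert, Finset.mem_singleton] at hi
    rcases hi with rfl | rfl | rfl <;> simp [*]
  have := Finset.card_le_card h
  rw [Finset.card_eq_three.mpr ⟨a, b, c, hab, hac, hbc, rfl⟩] at this
  exact_mod_cast this

theorem siteCount_union [DecidableEq ι] {Z O : Finset ι} (hd : Disjoint Z O) (p : ℤ) (x : ι → ℤ) :
    siteCount (Z ∪ O) p x = siteCount Z p x + siteCount O p x := by
  unfold siteCount
  rw [Finset.filter_union, Finset.card_union_of_disjoint]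
  · push_cast; rfl
  · exact Finset.disjoint_filter_filter hd

theorem siteCount_eq_rightCount (A : Finset ι) (p : ℤ) (x : ι → ℤ) :
    siteCount A p x = rightCount A (p - 1) x - rightCount A p x := by
  rw [siteCount_eq, rightCount_eq, rightCount_eq, sub_add_cancel]
  ring

theorem rightCount_neg (A : Finset ι) (t : ℤ) (x : ι → ℤ) :
    rightCount A t (-x) = A.card - rightCount A (-t - 1) x := by
  unfold rightCount
  rw [← Finset.card_filter_add_card_filter_not (s := A) (fun i => -t - 1 < x i)]
  push_cast
  have : (A.filter fun i => t < (-x) i) = A.filter fun i => ¬ (-t - 1 < x i) := by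
    refine Finset.filter_congr fun i _ => ?_
    rw [Pi.neg_apply]
    omega
  rw [this]
  ring

theorem siteCount_neg (A : Finset ι) (p : ℤ) (x : ι → ℤ) :
    siteCount A p (-x) = siteCount A (-p) x := by
  unfold siteCount
  congr 2
  ext i
  simp only [Pi.neg_apply, Finset.mem_filter]
  constructor <;> rintro ⟨h, h'⟩ <;> exact ⟨h, by omega⟩

end Potential

/-! ### Firing with two kinds of chips, and the obstacle principle. -/

section Fire

variable {ι : Type*} [DecidableEq ι]

/-- A firing move at the site `p` of chips of two kinds: the chips of `Z` have smaller labels than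
those of `O`. -/
def Fire (Z O : Finset ι) (p : ℤ) (x y : ι → ℤ) : Prop :=
  ∃ a b c : ι, a ∈ Z ∪ O ∧ b ∈ Z ∪ O ∧ c ∈ Z ∪ O ∧ a ≠ b ∧ b ≠ c ∧ a ≠ c ∧
    x a = p ∧ x b = p ∧ x c = p ∧ (a ∈ O → b ∈ O) ∧ (b ∈ O → c ∈ O) ∧
    y = x + Pi.single c 1 - Pi.single a 1

/-- The configuration `x` is reachable from the one with all chips at the origin. -/
def Reach (Z O : Finset ι) (x : ι → ℤ) : Prop :=
  Relation.ReflTransGen (fun x y => ∃ p, Fire Z O p x y) 0 x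

theorem excess_move (A : Finset ι) {a c : ι} (hac : a ≠ c) {x : ι → ℤ} {p : ℤ} (ha : x a = p)
    (hc : x c = p) (t : ℤ) :
    excess A t (x + Pi.single c 1 - Pi.single a 1) =
      excess A t x - (if a ∈ A ∧ t < p then 1 else 0) + (if c ∈ A ∧ t ≤ p then 1 else 0) := by
  have h : ∀ i ∈ A, max ((x + Pi.single c 1 - Pi.single a 1 : ι → ℤ) i - t) 0 =
      max (x i - t) 0 - (if i = a then (if t < p then 1 else 0) else 0) +
        (if i = c then (if t ≤ p then 1 else 0) else 0) := by
    intro i _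
    simp only [Pi.sub_apply, Pi.add_apply, Pi.single_apply]
    by_cases h1 : i = a
    · subst h1
      simp only [hac, if_true, if_false]
      split_ifs <;> omega
    · by_cases h2 : i = c
      · subst h2
        simp only [h1, if_true, if_false]
        split_ifs <;> omega
      · simp [h1, h2]
  unfold excess
  rw [Finset.sum_congr rfl h, Finset.sum_add_distrib, Finset.sum_sub_distrib,
    Finset.sum_ite_eq', Finset.sum_ite_eq']
  simp only [ite_and]

/-- The cases are given by the kinds of the two moving chips. A chip of `O` never moves left while
one of `Z` moves right, so apart from firings by one kind alone, only a `Z` going left with an `O`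
going right is possible. -/
theorem Fire.effect {Z O : Finset ι} (hd : Disjoint Z O) {p : ℤ} {x y : ι → ℤ}
    (h : Fire Z O p x y) :
    (3 ≤ siteCount Z p x ∧ (∀ t, excess Z t y = excess Z t x + if t = p then 1 else 0) ∧
      (∀ t, excess O t y = excess O t x)) ∨
    (3 ≤ siteCount O p x ∧ (∀ t, excess O t y = excess O t x + if t = p then 1 else 0) ∧
      (∀ t, excess Z t y = excess Z t x)) ∨
    (1 ≤ siteCount Z p x ∧ 1 ≤ siteCount O p x ∧ 3 ≤ siteCount Z p x + siteCount O p x ∧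
      (∀ t, excess Z t y = excess Z t x - if t < p then 1 else 0) ∧
      (∀ t, excess O t y = excess O t x + if t ≤ p then 1 else 0)) := by
  obtain ⟨a, b, c, ha, hb, hc, hab, hbc, hac, hxa, hxb, hxc, h1, h2, rfl⟩ := h
  have hdz : ∀ i, i ∈ Z → i ∉ O := fun i hi => Finset.disjoint_left.mp hd hi
  have h3 := siteCount_union hd p x ▸ three_le_siteCount ha hb hc hab hbc hac hxa hxb hxc
  rw [Finset.mem_union] at ha hb hc
  by_cases haO : a ∈ O
  · have hbO := h1 haO
    have hcO := h2 hbO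
    have haZ : a ∉ Z := fun h => hdz _ h haO
    have hcZ : c ∉ Z := fun h => hdz _ h hcO
    refine Or.inr (Or.inl ⟨three_le_siteCount haO hbO hcO hab hbc hac hxa hxb hxc, ?_, ?_⟩) <;>
      intro t <;> rw [excess_move _ hac hxa hxc]
    · simp only [haO, hcO, true_and]
      split_ifs <;> omega
    · simp [haZ, hcZ]
  · have haZ : a ∈ Z := ha.resolve_right haO
    by_cases hcO : c ∈ O
    · have hcZ : c ∉ Z := fun h => hdz _ h hcO
      refine Or.inr (Or.inr ⟨one_le_siteCount haZ hxa, one_le_siteCount hcO hxc, h3, ?_, ?_⟩) <;>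
        intro t <;> rw [excess_move _ hac hxa hxc]
      · simp [haZ, hcZ]
      · simp [haO, hcO]
    · have hbO : b ∉ O := fun h => hcO (h2 h)
      have hbZ := hb.resolve_right hbO
      have hcZ := hc.resolve_right hcO
      refine Or.inl ⟨three_le_siteCount haZ hbZ hcZ hab hbc hac hxa hxb hxc, ?_, ?_⟩ <;>
        intro t <;> rw [excess_move _ hac hxa hxc]
      · simp only [haZ, hcZ, true_and]
        split_ifs <;> omega
      · simp [haO, hcO]

theorem Fire.mirror {Z O : Finset ι} (hd : Disjoint Z O) {p : ℤ} {x y : ι → ℤ}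
    (h : Fire Z O p x y) : Fire O Z (-p) (-x) (-y) := by
  obtain ⟨a, b, c, ha, hb, hc, hab, hbc, hac, hxa, hxb, hxc, h1, h2, rfl⟩ := h
  have hdz : ∀ i, i ∈ Z → i ∉ O := fun i hi => Finset.disjoint_left.mp hd hi
  refine ⟨c, b, a, ?_, ?_, ?_, hbc.symm, hab.symm, hac.symm, ?_, ?_, ?_, ?_, ?_, ?_⟩
  · rwa [Finset.union_comm]
  · rwa [Finset.union_comm]
  · rwa [Finset.union_comm]
  · simp [hxc]
  · simp [hxb]
  · simp [hxa]
  · intro hcZ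
    rw [Finset.mem_union] at hb
    exact hb.resolve_right fun hbO => hdz _ hcZ (h2 hbO)
  · intro hbZ
    rw [Finset.mem_union] at ha
    exact ha.resolve_right fun haO => hdz _ hbZ (h1 haO)
  · abel

theorem Reach.mirror {Z O : Finset ι} (hd : Disjoint Z O) {x : ι → ℤ} (h : Reach Z O x) :
    Reach O Z (-x) := by
  induction h with
  | refl => rw [neg_zero]; exact Relation.ReflTransGen.refl
  | tail _ h ih => exact ih.tail ⟨_, h.choose_spec.mirror hd⟩

theorem Reach.fire {Z O : Finset ι} {x y : ι → ℤ} {p : ℤ} (h : Reach Z O x)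
    (hf : Fire Z O p x y) : Reach Z O y := Relation.ReflTransGen.tail h ⟨p, hf⟩

/-- Firing moves far apart commute. -/
theorem Fire.swap {Z O : Finset ι} {p q : ℤ} {w x y : ι → ℤ} (h : Fire Z O q w x)
    (h' : Fire Z O p x y) (h0 : p ≠ q) (h1 : p ≠ q + 1) (h2 : p ≠ q - 1) :
    ∃ v, Fire Z O p w v ∧ Fire Z O q v y := by
  obtain ⟨a, b, c, ha, hb, hc, hab, hbc, hac, hxa, hxb, hxc, g1, g2, rfl⟩ := h
  obtain ⟨a', b', c', ha', hb', hc', hab', hbc', hac', hxa', hxb', hxc', g1', g2', rfl⟩ := h'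
  have key : ∀ i, (w + Pi.single c 1 - Pi.single a 1 : ι → ℤ) i = p → w i = p := by
    intro i hi
    simp only [Pi.sub_apply, Pi.add_apply, Pi.single_apply] at hi
    split_ifs at hi with e1 e2 e2
    · exact absurd (e1.symm.trans e2) hac.symm
    · subst e1; omega
    · subst e2; omega
    · omega
  have ka := key _ hxa'
  have kb := key _ hxb'
  have kc := key _ hxc'
  have far : ∀ i, w i = q → (w + Pi.single c' 1 - Pi.single a' 1 : ι → ℤ) i = q := by
    intro i hi
    have e1 : i ≠ c' := by rintro rfl; exact h0 (kc.symm.trans hi)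
    have e2 : i ≠ a' := by rintro rfl; exact h0 (ka.symm.trans hi)
    simp [e1, e2, hi]
  exact ⟨_, ⟨a', b', c', ha', hb', hc', hab', hbc', hac', ka, kb, kc, g1', g2', rfl⟩,
    ⟨a, b, c, ha, hb, hc, hab, hbc, hac, far _ hxa, far _ hxb, far _ hxc, g1, g2, by abel⟩⟩

/-- A function whose second differences are at most `2` and which bounds `excess` initially bounds
it for ever. -/
theorem excess_le_of_obstacle {Z O : Finset ι} (hd : Disjoint Z O) {f : ℤ → ℤ}
    (hf : ∀ p, f (p - 1) + f (p + 1) ≤ 2 * f p + 2) (h0 : ∀ t, excess Z t 0 ≤ f t) {x : ι → ℤ}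
    (h : Reach Z O x) (t : ℤ) : excess Z t x ≤ f t := by
  induction h generalizing t with
  | refl => exact h0 t
  | @tail x y _ hxy ih =>
    obtain ⟨p, hp⟩ := hxy
    rcases hp.effect hd with ⟨h3, hz, _⟩ | ⟨_, _, hz⟩ | ⟨_, _, _, hz, _⟩ <;> rw [hz]
    · split_ifs with e
      · subst e
        -- Three chips make the second difference of the excess at least `3`. That of `f` is at most
        -- `2`, so the excess at `t` is still strictly below `f t` and may grow by one.
        rw [siteCount_eq] at h3
        have := ih (t - 1)
        have := ih (t + 1)
        have := hf t
        omega
      · have := ih t; omega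
    · exact ih t
    · have := ih t
      split_ifs <;> omega

end Fire

/-! ### Quarter squares as obstacles for the excess. -/

/-- The integer part of `x ^ 2 / 4` for `0 ≤ x`, and `0` otherwise. -/
def quarterSq (x : ℤ) : ℤ := max x 0 / 2 * ((max x 0 + 1) / 2)

theorem quarterSq_of_le_one {x : ℤ} (h : x ≤ 1) : quarterSq x = 0 := by
  unfold quarterSq
  have : max x 0 / 2 = 0 := by omega
  rw [this, zero_mul]

theorem quarterSq_succ {x : ℤ} (h : 0 ≤ x) : quarterSq (x + 1) = quarterSq x + (x + 1) / 2 := by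
  unfold quarterSq
  rw [max_eq_left h, max_eq_left (by omega : 0 ≤ x + 1)]
  have : (x + 1 + 1) / 2 = x / 2 + 1 := by omega
  rw [this]
  ring

theorem quarterSq_nonneg (x : ℤ) : 0 ≤ quarterSq x := by
  unfold quarterSq
  exact mul_nonneg (by omega) (by omega)

theorem sq_le_quarterSq {x : ℤ} (h : 0 ≤ x) : x ^ 2 ≤ 4 * quarterSq x + 1 := by
  unfold quarterSq
  rw [max_eq_left h]
  obtain ⟨t, rfl | rfl⟩ := Int.even_or_odd' x
  · have h1 : 2 * t / 2 = t := by omega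
    have h2 : (2 * t + 1) / 2 = t := by omega
    rw [h1, h2]; nlinarith
  · have h1 : (2 * t + 1) / 2 = t := by omega
    have h2 : (2 * t + 1 + 1) / 2 = t + 1 := by omega
    rw [h1, h2]; nlinarith

theorem quarterSq_diff (x : ℤ) : quarterSq (x + 1) = quarterSq x + max ((x + 1) / 2) 0 := by
  rcases le_or_gt 0 x with h | h
  · rw [quarterSq_succ h]; omega
  · rw [quarterSq_of_le_one (by omega), quarterSq_of_le_one (by omega)]; omega

theorem quarterSq_mono {x y : ℤ} (h : x ≤ y) : quarterSq x ≤ quarterSq y := by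
  induction y, h using Int.leInduction with
  | base => exact le_rfl
  | succ y _ ih => rw [quarterSq_diff]; omega

theorem quarterSq_second_diff (x : ℤ) :
    quarterSq (x + 2) + quarterSq (x - 2) ≤ 2 * quarterSq x + 2 := by
  have h1 := quarterSq_diff (x - 2)
  have h2 := quarterSq_diff (x - 1)
  have h3 := quarterSq_diff x
  have h4 := quarterSq_diff (x + 1)
  rw [show x - 2 + 1 = x - 1 by ring] at h1
  rw [show x - 1 + 1 = x by ring] at h2
  rw [show x + 1 + 1 = x + 2 by ring] at h4
  omega

section Bound

variable {ι : Type*} [DecidableEq ι] {Z O : Finset ι}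

/-- The obstacle `t ↦ quarterSq (h - 2 * t)` has second differences at most `2`. It starts above the
excess since `8h|t| ≤ (h + 2|t|)^2` for `t < 0`. -/
theorem excess_le_quarterSq (hd : Disjoint Z O) {h : ℤ} (hc : (Z.card : ℤ) ≤ 2 * h) {x : ι → ℤ}
    (hx : Reach Z O x) (t : ℤ) : excess Z t x ≤ quarterSq (h - 2 * t) := by
  have hh : 0 ≤ h := by have : (0 : ℤ) ≤ Z.card := Int.natCast_nonneg _; omega
  refine excess_le_of_obstacle (f := fun t => quarterSq (h - 2 * t)) hd (fun p => ?_) (fun t => ?_)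
    hx t
  · have := quarterSq_second_diff (h - 2 * p)
    rw [show h - 2 * (p - 1) = h - 2 * p + 2 by ring,
      show h - 2 * (p + 1) = h - 2 * p - 2 by ring]
    exact this
  · rw [excess_zero]
    rcases le_or_gt 0 t with ht | ht
    · rw [max_eq_right (by omega), mul_zero]
      exact quarterSq_nonneg _
    · rw [max_eq_left (by omega)]
      have h1 := sq_le_quarterSq (x := h - 2 * t) (by omega)
      have h2 : (Z.card : ℤ) * -t ≤ 2 * h * -t := mul_le_mul_of_nonneg_right hc (by omega)
      have h3 := sq_nonneg (h + 2 * t)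
      have h4 : 8 * (h * -t) ≤ (h - 2 * t) ^ 2 := by nlinarith
      have h5 : 2 * h * -t = 2 * (h * -t) := by ring
      omega

end Bound

/-! ### The number of firings still to come at each site. -/

/-- The total excess of the final configuration of `4 * m - 1` chips. -/
def finalExcess (m p : ℤ) : ℤ := (4 * m - 1) * max (-p) 0 + (max (m - max p (-p)) 0) ^ 2

/-- The number of chips to the right of `p` in the final configuration of `4 * m - 1` chips. -/
def finalRight (m p : ℤ) : ℤ :=
  if p < -m then 4 * m - 1 else if p < 0 then 2 * m - 2 * p - 2
  else if p < m then 2 * (m - p) - 1 else 0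

theorem finalExcess_step (m p : ℤ) (hm : 0 ≤ m) :
    finalExcess m p = finalExcess m (p + 1) + finalRight m p := by
  unfold finalExcess finalRight
  split_ifs with h1 h2 h3
  · rw [max_eq_left (by omega : 0 ≤ -p), max_eq_left (by omega : 0 ≤ -(p + 1)),
      max_eq_right (by omega : m - max p (-p) ≤ 0),
      max_eq_right (by omega : m - max (p + 1) (-(p + 1)) ≤ 0)]
    ring
  · rw [max_eq_left (by omega : 0 ≤ -p), max_eq_left (by omega : 0 ≤ -(p + 1)),
      max_eq_right (by omega : p ≤ -p), max_eq_right (by omega : p + 1 ≤ -(p + 1)) ,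
      max_eq_left (by omega : 0 ≤ m - -p)]
    rcases le_or_gt 0 (m - -(p + 1)) with h | h
    · rw [max_eq_left h]; ring
    · omega
  · rw [max_eq_right (by omega : -p ≤ 0), max_eq_right (by omega : -(p + 1) ≤ 0),
      max_eq_left (by omega : -p ≤ p), max_eq_left (by omega : -(p + 1) ≤ p + 1) ,
      max_eq_left (by omega : 0 ≤ m - p), max_eq_left (by omega : 0 ≤ m - (p + 1))]
    ring
  · rw [max_eq_right (by omega : -p ≤ 0), max_eq_right (by omega : -(p + 1) ≤ 0),
      max_eq_right (by omega : m - max p (-p) ≤ 0),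
      max_eq_right (by omega : m - max (p + 1) (-(p + 1)) ≤ 0)]
    ring

section Remaining

variable {ι : Type*}

/-- The number of firings of the site `p` that are still to come at `x`. -/
def remaining (m : ℤ) (Z O : Finset ι) (x : ι → ℤ) (p : ℤ) : ℤ :=
  finalExcess m p - excess Z p x - excess O p x

variable {m : ℤ} {Z O : Finset ι}

theorem siteCount_add (hm : 1 ≤ m) (x : ι → ℤ) (p : ℤ) :
    siteCount Z p x + siteCount O p x = finalRight m (p - 1) - finalRight m p +
      2 * remaining m Z O x p - remaining m Z O x (p - 1) - remaining m Z O x (p + 1) := by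
  have h1 := finalExcess_step m (p - 1) (by omega)
  have h2 := finalExcess_step m p (by omega)
  rw [sub_add_cancel] at h1
  rw [siteCount_eq, siteCount_eq]
  unfold remaining
  omega

theorem rightCount_add (hm : 1 ≤ m) (x : ι → ℤ) (p : ℤ) :
    rightCount Z p x + rightCount O p x = finalRight m p - remaining m Z O x p +
      remaining m Z O x (p + 1) := by
  have h2 := finalExcess_step m p (by omega)
  rw [rightCount_eq, rightCount_eq]
  unfold remaining
  omega

theorem remaining_zero (hN : (Z.card : ℤ) + O.card = 4 * m - 1) (p : ℤ) :
    remaining m Z O 0 p = (max (m - max p (-p)) 0) ^ 2 := by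
  unfold remaining
  rw [excess_zero, excess_zero, finalExcess, ← hN]
  ring

variable [DecidableEq ι]

theorem remaining_fire (hd : Disjoint Z O) {p : ℤ} {x y : ι → ℤ} (h : Fire Z O p x y) (t : ℤ) :
    remaining m Z O y t = remaining m Z O x t - if t = p then 1 else 0 := by
  unfold remaining
  rcases h.effect hd with ⟨_, h1, h2⟩ | ⟨_, h1, h2⟩ | ⟨_, _, _, h1, h2⟩ <;> rw [h1, h2] <;>
    split_ifs <;> omega

theorem Fire.three_le (hd : Disjoint Z O) {p : ℤ} {x y : ι → ℤ} (h : Fire Z O p x y) :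
    3 ≤ siteCount Z p x + siteCount O p x := by
  have := siteCount_nonneg Z p x
  have := siteCount_nonneg O p x
  rcases h.effect hd with ⟨_, h1, h2⟩ | ⟨_, h1, h2⟩ | ⟨_, _, _, h1, h2⟩ <;> omega

/-- Least action: a site with nothing remaining, next to nonnegative values, holds at most its final
number of chips, hence at most two, and cannot fire. -/
theorem remaining_nonneg (hd : Disjoint Z O) (hm : 1 ≤ m)
    (hN : (Z.card : ℤ) + O.card = 4 * m - 1) {x : ι → ℤ} (h : Reach Z O x) (p : ℤ) :
    0 ≤ remaining m Z O x p := by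
  induction h generalizing p with
  | refl => rw [remaining_zero hN]; positivity
  | @tail x y _ hxy ih =>
    obtain ⟨q, hq⟩ := hxy
    rw [remaining_fire hd hq]
    have h3 := hq.three_le hd
    rw [siteCount_add hm] at h3
    have h4 := ih p
    split_ifs with e
    · subst e
      have := ih (p - 1)
      have := ih (p + 1)
      unfold finalRight at h3
      split_ifs at h3 <;> omega
    · omega

theorem remaining_le (hd : Disjoint Z O) (hN : (Z.card : ℤ) + O.card = 4 * m - 1) {x : ι → ℤ}
    (h : Reach Z O x) (p : ℤ) : remaining m Z O x p ≤ (max (m - max p (-p)) 0) ^ 2 := by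
  induction h generalizing p with
  | refl => rw [remaining_zero hN]
  | @tail x y _ hxy ih =>
    obtain ⟨q, hq⟩ := hxy
    rw [remaining_fire hd hq]
    have := ih p
    split_ifs <;> omega

theorem remaining_eq_zero_of_far (hd : Disjoint Z O) (hm : 1 ≤ m)
    (hN : (Z.card : ℤ) + O.card = 4 * m - 1) {x : ι → ℤ} (h : Reach Z O x) {p : ℤ}
    (hp : m ≤ max p (-p)) : remaining m Z O x p = 0 := by
  have h1 := remaining_nonneg hd hm hN h p
  have h2 := remaining_le hd hN h p
  rw [max_eq_right (by omega)] at h2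
  omega

/-- A nonnegative function that vanishes at the far end `m` and is convex in between is
decreasing, and strictly so at `0` unless it vanishes. -/
theorem convex_decreasing {w : ℤ → ℤ} {m : ℤ} (hw : ∀ p, 0 ≤ w p) (hm : w m = 0)
    (hc : ∀ p, 0 < p → p < m → 2 * w p ≤ w (p - 1) + w (p + 1)) (n : ℕ) :
    (n : ℤ) + 1 ≤ m → w (m - n) ≤ w (m - n - 1) ∧ (w (m - n - 1) ≤ w (m - n) → w (m - n) = 0) := by
  induction n with
  | zero => intro _; have := hw (m - 1); simp [hm, this]
  | succ n ih =>
    intro hn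
    push_cast at hn ⊢
    have h1 := ih (by omega)
    have h2 := hc (m - n - 1) (by omega) (by omega)
    rw [show m - n - 1 + 1 = m - n by ring] at h2
    rw [show m - (n + 1 : ℤ) = m - n - 1 by ring]
    have := hw (m - n)
    omega

theorem convex_profile {w : ℤ → ℤ} {m : ℤ} (hm1 : 1 ≤ m) (hw : ∀ p, 0 ≤ w p) (hm : w m = 0)
    (hc : ∀ p, 0 < p → p < m → 2 * w p ≤ w (p - 1) + w (p + 1)) :
    w 1 ≤ w 0 ∧ (w 0 ≤ w 1 → ∀ p, 0 ≤ p → p ≤ m → w p = 0) := by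
  have key : ∀ p, 0 ≤ p → p < m → w (p + 1) ≤ w p ∧ (w p ≤ w (p + 1) → w (p + 1) = 0) := by
    intro p h1 h2
    have := convex_decreasing hw hm hc (m - p - 1).toNat (by omega)
    rw [Int.toNat_of_nonneg (by omega), show m - (m - p - 1) = p + 1 by ring,
      show p + 1 - 1 = p by ring] at this
    exact this
  refine ⟨(key 0 le_rfl (by omega)).1, fun h p hp => ?_⟩
  induction p, hp using Int.leInduction with
  | base => intro _; have := key 0 le_rfl (by omega); rw [zero_add] at this; omega
  | succ p hp ih =>
    intro h'
    have := key p hp (by omega)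
    have := ih (by omega)
    have := hw (p + 1)
    omega

/-- At most two chips per site makes `remaining` convex on each side of `0`, and it vanishes at
`±m`. Unless it is zero, it drops by at least one from `0` to both neighbours; then the site `0`,
whose final number is one, would hold at least three chips. -/
theorem remaining_eq_zero_of_final (hd : Disjoint Z O) (hm : 1 ≤ m)
    (hN : (Z.card : ℤ) + O.card = 4 * m - 1) {x : ι → ℤ} (h : Reach Z O x)
    (hf : ∀ p, siteCount Z p x + siteCount O p x ≤ 2) (p : ℤ) : remaining m Z O x p = 0 := by
  have hn := remaining_nonneg hd hm hN h
  have hz := fun q => remaining_eq_zero_of_far hd hm hN h (p := q)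
  have hcv : ∀ q, q ≠ 0 → -m < q → q < m → 2 * remaining m Z O x q ≤
      remaining m Z O x (q - 1) + remaining m Z O x (q + 1) := by
    intro q h0 h1 h2
    have := hf q
    rw [siteCount_add hm] at this
    unfold finalRight at this
    split_ifs at this <;> omega
  have h0 := hf 0
  rw [siteCount_add hm] at h0
  unfold finalRight at h0
  have h1 := convex_profile hm hn (hz m (by omega)) fun q _ _ => hcv q (by omega) (by omega) (by omega)
  have h2 := convex_profile (w := fun q => remaining m Z O x (-q)) hm (fun q => hn _)
    (hz (-m) (by omega)) fun q _ _ => by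
      have := hcv (-q) (by omega) (by omega) (by omega)
      rw [show -q - 1 = -(q + 1) by ring, show -q + 1 = -(q - 1) by ring] at this
      omega
  simp only [neg_zero, zero_sub, zero_add] at h0 h1 h2
  have h3 : remaining m Z O x 0 = 0 := by
    have e1 := h1.2
    have e2 := h2.2
    rcases le_or_gt (remaining m Z O x 0) (remaining m Z O x 1) with e | e
    · exact e1 e 0 le_rfl (by omega)
    · rcases le_or_gt (remaining m Z O x 0) (remaining m Z O x (-1)) with e' | e'
      · exact e2 e' 0 le_rfl (by omega)
      · split_ifs at h0 <;> omega
  have n1 := hn 1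
  have n2 := hn (-1)
  rcases le_or_gt m (max p (-p)) with hp | hp
  · exact hz p hp
  · rcases le_or_gt 0 p with h' | h'
    · exact h1.2 (by omega) p h' (by omega)
    · have := h2.2 (by omega) (-p) (by omega) (by omega)
      rwa [neg_neg] at this

/-! ### The forced order of the last firings, and postponing them. -/

/-- The values of `r`, cut off at `m - |p|`, decrease by at most `1` from each site to the next one
farther from the origin. -/
def Profile (m : ℤ) (r : ℤ → ℤ) : Prop :=
  (∀ p, 0 ≤ p → p < m → min (r p) (m - p) ≤ r (p + 1) + 1 ∧ min (r (p + 1)) (m - p - 1) ≤ r p) ∧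
  (∀ p, p ≤ 0 → -m < p → min (r p) (m + p) ≤ r (p - 1) + 1 ∧ min (r (p - 1)) (m + p - 1) ≤ r p)

/-- Three chips at `q` bound the sum of the two neighbouring values from above, and the profile
bounds each of them from below. The bounds meet, so all are equalities. -/
theorem Profile.neighbour {r : ℤ → ℤ} (h : Profile m r) {q : ℤ} (hq : max q (-q) < m)
    (h3 : 3 ≤ finalRight m (q - 1) - finalRight m q + 2 * r q - r (q - 1) - r (q + 1))
    (hr : r q ≤ m - max q (-q)) :
    (0 ≤ q → r (q + 1) = r q - 1) ∧ (0 < q → r (q - 1) = r q) ∧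
    (q ≤ 0 → r (q - 1) = r q - 1) ∧ (q < 0 → r (q + 1) = r q) := by
  unfold finalRight at h3
  rcases lt_trichotomy q 0 with h0 | h0 | h0
  · have h1 := (h.2 q (by omega) (by omega)).1
    have h2 := (h.2 (q + 1) (by omega) (by omega)).2
    rw [add_sub_cancel_right, min_eq_left (by omega)] at h2
    rw [min_eq_left (by omega)] at h1
    rw [if_neg (by omega), if_pos (by omega), if_neg (by omega), if_pos (by omega)] at h3
    omega
  · subst h0
    have h1 := (h.1 0 (by omega) (by omega)).1
    have h2 := (h.2 0 (by omega) (by omega)).1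
    rw [min_eq_left (by omega)] at h1 h2
    rw [if_neg (by omega), if_pos (by omega), if_neg (by omega), if_neg (by omega),
      if_pos (by omega)] at h3
    omega
  · have h1 := (h.1 q (by omega) (by omega)).1
    have h2 := (h.1 (q - 1) (by omega) (by omega)).2
    rw [sub_add_cancel, min_eq_left (by omega)] at h2
    rw [min_eq_left (by omega)] at h1
    rw [if_neg (by omega), if_neg (by omega), if_pos (by omega), if_neg (by omega),
      if_neg (by omega), if_pos (by omega)] at h3
    omega

theorem Profile.update {r s : ℤ → ℤ} (h : Profile m r) {q : ℤ}
    (hn : r q ≤ m - max q (-q) → (0 ≤ q → r (q + 1) = r q - 1) ∧ (0 < q → r (q - 1) = r q) ∧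
      (q ≤ 0 → r (q - 1) = r q - 1) ∧ (q < 0 → r (q + 1) = r q))
    (hs : ∀ p, s p = r p - if p = q then 1 else 0) : Profile m s := by
  constructor <;> intro p h1 h2
  · have hp := h.1 p h1 h2
    rw [hs, hs]
    by_cases e : p = q
    · subst e
      rw [if_pos rfl, if_neg (by omega)]
      rw [max_eq_left (by omega)] at hn
      constructor <;> omega
    · rw [if_neg e]
      split_ifs with e'
      · subst e'
        rw [max_eq_left (by omega), add_sub_cancel_right] at hn
        constructor <;> omega
      · simpa using hp
  · have hp := h.2 p h1 h2
    rw [hs, hs]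
    by_cases e : p = q
    · subst e
      rw [if_pos rfl, if_neg (by omega)]
      rw [max_eq_right (by omega)] at hn
      constructor <;> omega
    · rw [if_neg e]
      split_ifs with e'
      · subst e'
        rw [max_eq_right (by omega), sub_add_cancel] at hn
        constructor <;> omega
      · simpa using hp

theorem Fire.abs_lt (hd : Disjoint Z O) (hm : 1 ≤ m)
    (hN : (Z.card : ℤ) + O.card = 4 * m - 1) {x y : ι → ℤ} (hx : Reach Z O x) {q : ℤ}
    (hq : Fire Z O q x y) : max q (-q) < m := by
  by_contra hcon
  have hn := remaining_nonneg hd hm hN (Reach.fire hx hq) q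
  rw [remaining_fire hd hq, if_pos rfl] at hn
  have := remaining_eq_zero_of_far hd hm hN hx (p := q)
  omega

theorem remaining_profile (hd : Disjoint Z O) (hm : 1 ≤ m)
    (hN : (Z.card : ℤ) + O.card = 4 * m - 1) {x : ι → ℤ} (h : Reach Z O x) :
    Profile m (remaining m Z O x) := by
  induction h with
  | refl =>
    have key : ∀ q, max (m - max q (-q)) 0 ≤ remaining m Z O 0 q := by
      intro q
      rw [remaining_zero hN]
      rcases le_or_gt (m - max q (-q)) 0 with h | h
      · rw [max_eq_right h]; norm_num
      · rw [max_eq_left h.le]; nlinarith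
    constructor <;> intro p <;> intros
    · have h1 := key p
      have h2 := key (p + 1)
      omega
    · have h1 := key p
      have h2 := key (p - 1)
      omega
  | @tail x y hx hxy ih =>
    obtain ⟨q, hq⟩ := hxy
    have h3 := hq.three_le hd
    rw [siteCount_add hm] at h3
    exact ih.update (ih.neighbour (hq.abs_lt hd hm hN hx) h3) (remaining_fire hd hq)

/-- The last `m - |p|` firings of a site `p` are in a forced order with those of its neighbours. -/
theorem remaining_neighbour (hd : Disjoint Z O) (hm : 1 ≤ m)
    (hN : (Z.card : ℤ) + O.card = 4 * m - 1) {x y : ι → ℤ} (hx : Reach Z O x) {q : ℤ}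
    (hq : Fire Z O q x y) (hr : remaining m Z O x q ≤ m - max q (-q)) :
    max q (-q) < m ∧
    (0 ≤ q → remaining m Z O x (q + 1) = remaining m Z O x q - 1) ∧
    (0 < q → remaining m Z O x (q - 1) = remaining m Z O x q) ∧
    (q ≤ 0 → remaining m Z O x (q - 1) = remaining m Z O x q - 1) ∧
    (q < 0 → remaining m Z O x (q + 1) = remaining m Z O x q) := by
  have h3 := hq.three_le hd
  rw [siteCount_add hm] at h3
  exact ⟨hq.abs_lt hd hm hN hx,
    (remaining_profile hd hm hN hx).neighbour (hq.abs_lt hd hm hN hx) h3 hr⟩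

/-- A profile of remaining firings that can be reached by postponing firings. -/
structure IsCut (m : ℤ) (R : ℤ → ℤ) : Prop where
  le : ∀ p, R p ≤ max (m - max p (-p)) 0
  right : ∀ p, 0 ≤ p → p < m → R p ≤ R (p + 1) + 1 ∧ R (p + 1) ≤ R p
  left : ∀ p, p ≤ 0 → -m < p → R p ≤ R (p - 1) + 1 ∧ R (p - 1) ≤ R p

/-- A firing move that belongs to the last `R p` firings of its site. -/
def LateFire (m : ℤ) (Z O : Finset ι) (R : ℤ → ℤ) (x y : ι → ℤ) : Prop :=
  Reach Z O x ∧ ∃ p, remaining m Z O x p ≤ R p ∧ Fire Z O p x y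

/-- The slope conditions on `R` match the equalities of `remaining_neighbour`: once a site makes a
late firing, its neighbours have only late firings left. -/
theorem IsCut.neighbour {R : ℤ → ℤ} (hR : IsCut m R) (hd : Disjoint Z O) (hm : 1 ≤ m)
    (hN : (Z.card : ℤ) + O.card = 4 * m - 1) {x y : ι → ℤ} (hx : Reach Z O x) {q : ℤ}
    (hq : Fire Z O q x y) (hr : remaining m Z O x q ≤ R q) :
    remaining m Z O x (q + 1) ≤ R (q + 1) ∧ remaining m Z O x (q - 1) ≤ R (q - 1) := by
  have h0 := hR.le q
  have hn := remaining_nonneg hd hm hN (Reach.fire hx hq) q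
  rw [remaining_fire hd hq, if_pos rfl] at hn
  have h1 := remaining_neighbour hd hm hN hx hq (by omega)
  have h2 := hR.right q
  have h3 := hR.left q
  have h4 := hR.right (q - 1)
  have h5 := hR.left (q + 1)
  rw [sub_add_cancel] at h4
  rw [add_sub_cancel_right] at h5
  omega

theorem remaining_anti {R : ℤ → ℤ} (hd : Disjoint Z O) {x y : ι → ℤ}
    (h : Relation.ReflTransGen (LateFire m Z O R) x y) (p : ℤ) :
    remaining m Z O y p ≤ remaining m Z O x p := by
  induction h with
  | refl => exact le_rfl
  | tail _ h ih =>
    obtain ⟨_, q, _, hq⟩ := h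
    rw [remaining_fire hd hq]
    split_ifs <;> omega

/-- A site that still has an early firing is neither the site of a preceding late firing nor
adjacent to it, so the early firing can be moved in front of all the late ones. -/
theorem IsCut.commute {R : ℤ → ℤ} (hR : IsCut m R) (hd : Disjoint Z O) (hm : 1 ≤ m)
    (hN : (Z.card : ℤ) + O.card = 4 * m - 1) {w x : ι → ℤ}
    (h : Relation.ReflTransGen (LateFire m Z O R) w x) {p : ℤ}
    (hp : R p < remaining m Z O x p) {y : ι → ℤ} (hf : Fire Z O p x y) :
    ∃ v, Fire Z O p w v ∧ Relation.ReflTransGen (LateFire m Z O R) v y := by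
  induction h generalizing y with
  | refl => exact ⟨y, hf, .refl⟩
  | @tail u x huv hux ih =>
    obtain ⟨hu, q, hq, hfq⟩ := hux
    have h1 := remaining_fire (m := m) hd hfq p
    have h2 : R p < remaining m Z O u p := by split_ifs at h1 <;> omega
    have h3 := hR.neighbour hd hm hN hu hfq hq
    have n0 : p ≠ q := by rintro rfl; omega
    have n1 : p ≠ q + 1 := by rintro rfl; omega
    have n2 : p ≠ q - 1 := by rintro rfl; omega
    obtain ⟨u', hu', hu''⟩ := hfq.swap hf n0 n1 n2
    obtain ⟨v, hv, hv'⟩ := ih h2 hu'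
    refine ⟨v, hv, hv'.tail ⟨hu.fire hu', q, ?_, hu''⟩⟩
    rw [remaining_fire hd hu', if_neg n0.symm]
    omega

/-- Every configuration is reached by a firing sequence in which all late firings come last. -/
theorem IsCut.exists_state {R : ℤ → ℤ} (hR : IsCut m R) (hd : Disjoint Z O) (hm : 1 ≤ m)
    (hN : (Z.card : ℤ) + O.card = 4 * m - 1) {x : ι → ℤ} (hx : Reach Z O x) :
    ∃ w, Reach Z O w ∧ (∀ p, remaining m Z O w p = max (remaining m Z O x p) (R p)) ∧
      Relation.ReflTransGen (LateFire m Z O R) w x := by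
  induction hx with
  | refl =>
    refine ⟨0, .refl, fun p => ?_, .refl⟩
    have h := hR.le p
    rw [remaining_zero hN]
    refine (max_eq_left (h.trans ?_)).symm
    rcases le_or_gt (m - max p (-p)) 0 with h | h
    · rw [max_eq_right h]; norm_num
    · rw [max_eq_left h.le]; nlinarith
  | @tail x y hx hxy ih =>
    obtain ⟨w, hw, hr, hl⟩ := ih
    obtain ⟨p, hf⟩ := hxy
    rcases le_or_gt (remaining m Z O x p) (R p) with hp | hp
    · refine ⟨w, hw, fun q => ?_, hl.tail ⟨hx, p, hp, hf⟩⟩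
      rw [hr, remaining_fire hd hf]
      split_ifs with e
      · subst e; omega
      · omega
    · obtain ⟨v, hv, hv'⟩ := hR.commute hd hm hN hl hp hf
      refine ⟨v, hw.fire hv, fun q => ?_, hv'⟩
      rw [remaining_fire hd hv, remaining_fire hd hf, hr]
      split_ifs with e
      · subst e; omega
      · omega

/-- The last firing of a suitable firing sequence. -/
theorem IsCut.exists_fire {R : ℤ → ℤ} (hR : IsCut m R) (hd : Disjoint Z O) (hm : 1 ≤ m)
    (hN : (Z.card : ℤ) + O.card = 4 * m - 1) {y : ι → ℤ} (hy : Reach Z O y) {p : ℤ}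
    (h : ∀ q, remaining m Z O y q = R q - if q = p then 1 else 0) :
    ∃ x, Reach Z O x ∧ (∀ q, remaining m Z O x q = R q) ∧ Fire Z O p x y := by
  obtain ⟨x, hx, hr, hl⟩ := hR.exists_state hd hm hN hy
  have hr' : ∀ q, remaining m Z O x q = R q := by
    intro q
    rw [hr, h]
    split_ifs <;> omega
  refine ⟨x, hx, hr', ?_⟩
  rcases hl.cases_head with rfl | ⟨z, ⟨_, q, _, hz⟩, hl'⟩
  -- The remaining counts of `x` and `y` differ by one in total, so the late sequence consists of
  -- exactly one firing, at `p`.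
  · have h1 := h p
    rw [hr', if_pos rfl] at h1
    omega
  · have h1 := remaining_anti hd hl' q
    have h2 := h q
    rw [remaining_fire hd hz, if_pos rfl, hr'] at h1
    have e : q = p := by
      by_contra e
      rw [if_neg e] at h2
      omega
    subst e
    rcases hl'.cases_head with rfl | ⟨u, ⟨_, s, _, hu⟩, hl''⟩
    · exact hz
    · have h3 := remaining_anti hd hl'' s
      rw [remaining_fire hd hu, if_pos rfl, remaining_fire hd hz, hr'] at h3
      have h4 := h s
      omega

end Remaining

/-! ### Sweeps. -/

/-- The remaining firings in the middle of sweep number `k`: sweep `i` fires the sites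
`-i, …, m - 1 - i` once each, from left to right, and in sweep `k` the next site is `q`. -/
def sweepCut (m k q p : ℤ) : ℤ :=
  (if 0 ≤ p then max (m - k - p) 0 else max (m - max (-p) k) 0) - if -k ≤ p ∧ p < q then 1 else 0

theorem isCut_sweepCut {m k q : ℤ} (h0 : 0 ≤ k) (hq' : q ≤ m - k) : IsCut m (sweepCut m k q) := by
  constructor <;> intro p <;> intros <;> unfold sweepCut
  · split_ifs <;> omega
  · split_ifs <;> omega
  · split_ifs <;> omega

theorem sweepCut_succ (m k q p : ℤ) (hq : -k ≤ q) :
    sweepCut m k (q + 1) p = sweepCut m k q p - if p = q then 1 else 0 := by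
  unfold sweepCut
  split_ifs <;> omega

theorem sweepCut_next (m k p : ℤ) (h0 : 0 ≤ k) (hk : k < m) :
    sweepCut m (k + 1) (-(k + 1)) p = sweepCut m k (m - k) p := by
  unfold sweepCut
  split_ifs <;> omega

theorem sweepCut_of_le {m k p : ℤ} (h0 : 0 ≤ k) (hp : p ≤ -k) :
    sweepCut m k (-k) p = max (m + p) 0 := by
  unfold sweepCut
  split_ifs <;> omega

theorem finalRight_diff_le {m : ℤ} (hm : 1 ≤ m) (p : ℤ) :
    finalRight m (p - 1) - finalRight m p ≤ 2 := by
  unfold finalRight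
  split_ifs <;> omega

/-- With at most two chips per site, the excess of `n` chips beyond `k` is least when they are
packed in pairs next to `k`. The proof adds the lower bounds `n, n - 2, n - 4, …` for the numbers of
chips beyond successive sites. -/
theorem quarterSq_rightCount_le {ι : Type*} {A : Finset ι} {k : ℤ} {x : ι → ℤ}
    (h : ∀ p, k < p → siteCount A p x ≤ 2) :
    quarterSq (rightCount A k x + 1) ≤ excess A k x := by
  set n := rightCount A k x with hn
  have key : ∀ t : ℕ, n - 2 * t ≤ rightCount A (k + t) x ∧
      excess A (k + t) x + t * n - t * (t - 1) ≤ excess A k x := by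
    intro t
    induction t with
    | zero => simp [hn]
    | succ t ih =>
      have h1 := h (k + t + 1) (by omega)
      rw [siteCount_eq_rightCount, add_sub_cancel_right] at h1
      have h2 := rightCount_eq A (k + t) x
      push_cast
      rw [← add_assoc]
      constructor
      · omega
      · have h3 := ih.2
        have h4 : ((t : ℤ) + 1) * n - (t + 1) * (t + 1 - 1) =
          t * n - t * (t - 1) + n - 2 * t := by ring
        omega
  have hn0 : 0 ≤ n := rightCount_nonneg _ _ _
  have h1 := (key ((n + 1) / 2).toNat).2
  rw [Int.toNat_of_nonneg (by omega)] at h1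
  have h2 := excess_nonneg A (k + (n + 1) / 2) x
  unfold quarterSq
  rw [max_eq_left (by omega)]
  have h3 : (n + 1 + 1) / 2 = n + 1 - (n + 1) / 2 := by omega
  rw [h3]
  have h4 : (n + 1) / 2 * (n + 1 - (n + 1) / 2) =
    (n + 1) / 2 * n - (n + 1) / 2 * ((n + 1) / 2 - 1) := by ring
  omega

section Sweep

variable {ι : Type*} [DecidableEq ι] {m j k : ℤ} {Z O : Finset ι}

/-- With exactly three chips there is no choice of participants: a chip of `O` at `p` forces a chip
of `O` to move right. This is what lets a sweep carry such a chip. -/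
theorem Fire.effect_three (hd : Disjoint Z O) {p : ℤ} {x y : ι → ℤ} (h : Fire Z O p x y)
    (h3 : siteCount Z p x + siteCount O p x = 3) :
    (siteCount O p x = 0 ∧
      (∀ t, excess Z t y = excess Z t x + if t = p then 1 else 0) ∧
      (∀ t, rightCount Z t y = rightCount Z t x + (if t = p then 1 else 0) -
        if t = p - 1 then 1 else 0) ∧
      (∀ t, rightCount O t y = rightCount O t x)) ∨
    (siteCount Z p x = 0 ∧
      (∀ t, excess Z t y = excess Z t x) ∧
      (∀ t, rightCount Z t y = rightCount Z t x) ∧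
      (∀ t, rightCount O t y = rightCount O t x + (if t = p then 1 else 0) -
        if t = p - 1 then 1 else 0)) ∨
    (1 ≤ siteCount Z p x ∧ 1 ≤ siteCount O p x ∧
      (∀ t, excess Z t y = excess Z t x - if t < p then 1 else 0) ∧
      (∀ t, rightCount Z t y = rightCount Z t x - if t = p - 1 then 1 else 0) ∧
      (∀ t, rightCount O t y = rightCount O t x + if t = p then 1 else 0)) := by
  have hz := siteCount_nonneg Z p x
  have ho := siteCount_nonneg O p x
  rcases h.effect hd with ⟨g, h1, h2⟩ | ⟨g, h1, h2⟩ | ⟨g, g', _, h1, h2⟩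
  · refine Or.inl ⟨by omega, h1, fun t => ?_, fun t => ?_⟩
    · rw [rightCount_eq, rightCount_eq, h1, h1]; split_ifs <;> omega
    · rw [rightCount_eq, rightCount_eq, h2, h2]
  · refine Or.inr (Or.inl ⟨by omega, h2, fun t => ?_, fun t => ?_⟩)
    · rw [rightCount_eq, rightCount_eq, h2, h2]
    · rw [rightCount_eq, rightCount_eq, h1, h1]; split_ifs <;> omega
  · refine Or.inr (Or.inr ⟨g, g', h1, fun t => ?_, fun t => ?_⟩)
    · rw [rightCount_eq, rightCount_eq, h1, h1]; split_ifs <;> omega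
    · rw [rightCount_eq, rightCount_eq, h2, h2]; split_ifs <;> omega

/-- The configuration `x` occurs in sweep number `k` just before the site `q` is fired. -/
def AtSweep (m : ℤ) (Z O : Finset ι) (k q : ℤ) (x : ι → ℤ) : Prop :=
  Reach Z O x ∧ ∀ p, remaining m Z O x p = sweepCut m k q p

theorem AtSweep.exists_fire (hd : Disjoint Z O) (hN : (Z.card : ℤ) + O.card = 4 * m - 1)
    (h0 : 0 ≤ k) {q : ℤ} (hq : -k ≤ q) (hq' : q < m - k) {y : ι → ℤ}
    (hy : AtSweep m Z O k (q + 1) y) : ∃ x, AtSweep m Z O k q x ∧ Fire Z O q x y := by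
  obtain ⟨x, hx, hr, hf⟩ := (isCut_sweepCut h0 hq'.le).exists_fire hd (by omega) hN
    hy.1 fun p => (hy.2 p).trans (sweepCut_succ m k q p hq)
  exact ⟨x, ⟨hx, hr⟩, hf⟩

theorem AtSweep.next (h0 : 0 ≤ k) (hk : k < m) {x : ι → ℤ} :
    AtSweep m Z O (k + 1) (-(k + 1)) x ↔ AtSweep m Z O k (m - k) x := by
  unfold AtSweep
  simp only [sweepCut_next m k _ h0 hk]

theorem AtSweep.siteCount_eq_three (h0 : 0 ≤ k) (hk : k < m) {q : ℤ} (hq : -k ≤ q)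
    (hq' : q < m - k) {x : ι → ℤ} (hx : AtSweep m Z O k q x) :
    siteCount Z q x + siteCount O q x = 3 := by
  rw [siteCount_add (m := m) (by omega), hx.2, hx.2, hx.2]
  unfold finalRight sweepCut
  split_ifs <;> omega

theorem AtSweep.rightCount_add (h0 : 0 ≤ k) (hk : k < m) {q a : ℤ} (ha : 0 ≤ a) (haq : q ≤ a)
    (ha' : a < m - k) {x : ι → ℤ} (hx : AtSweep m Z O k q x) :
    rightCount Z a x + rightCount O a x = 2 * (m - a) - 2 := by
  rw [SelfLoopChips.rightCount_add (m := m) (by omega), hx.2, hx.2]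
  unfold finalRight sweepCut
  split_ifs <;> omega

/-- Only few chips of `O` lie to the left of the sites that the first `k` sweeps have fired. -/
theorem AtSweep.left_le (hd : Disjoint Z O) (hm : 1 ≤ m) (hO : (O.card : ℤ) ≤ 2 * j) (h0 : 0 ≤ k)
    {x : ι → ℤ} (hx : AtSweep m Z O k (-k) x) :
    O.card - rightCount O (-k - 1) x ≤ max 0 (j - k - 1) := by
  rw [← rightCount_neg]
  have h1 := excess_le_quarterSq hd.symm hO (hx.1.mirror hd) k
  have h2 : quarterSq (rightCount O k (-x) + 1) ≤ excess O k (-x) := by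
    -- Left of `-k` the remaining counts are still `max (m + p) 0`, which is convex there, so these
    -- sites hold at most their final number of chips.
    refine quarterSq_rightCount_le fun p hp => ?_
    rw [siteCount_neg]
    have h3 := siteCount_add (m := m) (Z := Z) (O := O) hm x (-p)
    have h4 := siteCount_nonneg Z (-p) x
    have h5 := finalRight_diff_le hm (-p)
    rw [hx.2, hx.2, hx.2, sweepCut_of_le h0 (by omega), sweepCut_of_le h0 (by omega),
      sweepCut_of_le h0 (by omega)] at h3
    omega
  by_contra hcon
  have h3 := quarterSq_succ (x := rightCount O k (-x)) (by omega)
  have h4 := quarterSq_mono (x := j - 2 * k) (y := rightCount O k (-x)) (by omega)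
  omega

/-- During a sweep, either a chip of `O` is being carried along, or no chip of `O` has been met. -/
theorem AtSweep.carry (hd : Disjoint Z O) (hN : (Z.card : ℤ) + O.card = 4 * m - 1)
    (hO : (O.card : ℤ) ≤ 2 * j) (h0 : 0 ≤ k) (hk : k < m) {q : ℤ} (hq : -k ≤ q) :
    q < m - k → ∀ x, AtSweep m Z O k q x →
      rightCount O q x < rightCount O (q - 1) x ∨
      (rightCount O (-k - 1) x = rightCount O q x ∧
        O.card - rightCount O (-k - 1) x ≤ max 0 (j - k - 1)) := by
  induction q, hq using Int.leInduction with
  | base =>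
    intro _ x hx
    have h1 := hx.left_le hd (by omega) hO h0
    have h2 := rightCount_anti O x (show -k - 1 ≤ -k by omega)
    omega
  | succ q hq ih =>
    intro hq' y hy
    obtain ⟨x, hx, hf⟩ := hy.exists_fire hd hN h0 hq (by omega)
    have h3 := hx.siteCount_eq_three h0 hk hq (by omega)
    have h4 := ih (by omega) x hx
    have h5 := rightCount_anti O x (show -k - 1 ≤ q - 1 by omega)
    have h6 := rightCount_anti O x (show q ≤ q + 1 by omega)
    have h7 := siteCount_eq_rightCount O q x
    have h8 := siteCount_nonneg Z q x
    rw [add_sub_cancel_right]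
    rcases hf.effect_three hd h3 with ⟨g, _, _, e⟩ | ⟨g, _, _, e⟩ | ⟨g, g', _, _, e⟩
    · rw [e, e, e]; omega
    · rw [e, e]
      rw [if_pos rfl, if_neg (by omega), if_neg (by omega), if_neg (by omega)]
      omega
    · rw [e, e]
      rw [if_pos rfl, if_neg (by omega)]
      omega

/-- The bound for the excess of `Z` that holds before sweep number `k`. -/
def SweepBound (m j : ℤ) (Z O : Finset ι) (k : ℤ) : Prop :=
  ∀ x, AtSweep m Z O k (-k) x → ∀ a, m - j ≤ a → excess Z a x ≤ quarterSq (2 * (m - a) - j - k)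

/-- Only a firing of `a` itself can raise the excess of `Z` at `a`, so the bound survives until the
sweep reaches `a`. -/
theorem SweepBound.before (hd : Disjoint Z O) (hN : (Z.card : ℤ) + O.card = 4 * m - 1)
    (h0 : 0 ≤ k) (hb : SweepBound m j Z O k) {q : ℤ} (hq : -k ≤ q) :
    q ≤ m - k → ∀ x, AtSweep m Z O k q x → ∀ a, m - j ≤ a → q ≤ a →
      excess Z a x ≤ quarterSq (2 * (m - a) - j - k) := by
  induction q, hq using Int.leInduction with
  | base => intro _ x hx a ha _; exact hb x hx a ha
  | succ q hq ih =>
    intro hq' y hy a ha haq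
    obtain ⟨x, hx, hf⟩ := hy.exists_fire hd hN h0 hq (by omega)
    have h1 := ih (by omega) x hx a ha (by omega)
    rcases hf.effect hd with ⟨_, e, _⟩ | ⟨_, _, e⟩ | ⟨_, _, _, e, _⟩ <;> rw [e]
    · rw [if_neg (by omega)]; omega
    · exact h1
    · split_ifs <;> omega

/-- What is known about the excess of `Z` at `a` once the site `a` has been fired in the sweep. -/
theorem SweepBound.after (hd : Disjoint Z O) (hN : (Z.card : ℤ) + O.card = 4 * m - 1)
    (hO : (O.card : ℤ) ≤ 2 * j) (hO' : 2 * j - 1 ≤ (O.card : ℤ)) (hj : j ≤ m)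
    (h0 : 0 ≤ k) (hk : k < j) (hb : SweepBound m j Z O k) {a : ℤ} (ha : m - j ≤ a)
    (ha' : a < m - k) {q : ℤ} (hq : a + 1 ≤ q) :
    q ≤ m - k → ∀ x, AtSweep m Z O k q x →
      (rightCount O q x < rightCount O (q - 1) x ∧
        2 * excess Z a x ≤ quarterSq (2 * (m - a) - j - k) + quarterSq (2 * (m - a) - j - k - 2) +
          rightCount Z (q - 1) x ∧ excess Z (m - k - 1) x = 0) ∨
      (rightCount Z a x ≤ 2 * (m - a) - j - k - 2 + (if q = a + 1 then 1 else 0) ∧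
        (q = a + 1 → q < m - k ∧ 1 ≤ siteCount Z q x)) := by
  have hkm : k < m := by omega
  induction q, hq using Int.leInduction with
  | base =>
    intro hq' y hy
    obtain ⟨x, hx, hf⟩ := hy.exists_fire hd hN h0 (by omega) ha'
    have h3 := hx.siteCount_eq_three h0 hkm (by omega) ha'
    have h4 := AtSweep.carry hd hN hO h0 hkm (by omega) ha' x hx
    have h5 := rightCount_anti O x (show -k - 1 ≤ a - 1 by omega)
    have h6 := rightCount_anti O x (show a ≤ a + 1 by omega)
    have h7 := siteCount_eq_rightCount O a x
    have h8 := siteCount_nonneg Z a x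
    have b0 := hb.before hd hN h0 (by omega) (by omega) x hx a ha le_rfl
    have b1 := hb.before hd hN h0 (by omega) (by omega) x hx (a + 1) (by omega) (by omega)
    have b2 := hb.before hd hN h0 (by omega) (by omega) x hx (m - k - 1) (by omega) (by omega)
    -- At `m - k - 1` the argument is `k + 2 - j`, at most `1` since `k < j`: no chip of `Z` lies
    -- beyond the last site of the sweep.
    rw [quarterSq_of_le_one (by omega)] at b2
    have n2 := excess_nonneg Z (m - k - 1) x
    have h9 := hx.rightCount_add h0 hkm (by omega) le_rfl ha'
    have r := rightCount_eq Z a x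
    rw [show 2 * (m - (a + 1)) - j - k = 2 * (m - a) - j - k - 2 by ring] at b1
    rw [add_sub_cancel_right]
    have nz := rightCount_nonneg Z a x
    have nz1 := rightCount_nonneg Z (a + 1) x
    rcases hf.effect_three hd h3 with ⟨g, e1, e2, e3⟩ | ⟨g, e1, e2, e3⟩ | ⟨g, g', e1, e2, e3⟩
    · right
      have e4 := e2 a
      have e5 := e2 (a + 1)
      rw [if_pos rfl, if_neg (by omega)] at e4
      rw [if_neg (by omega), if_neg (by omega)] at e5
      -- No chip of `O` has been met, so at most `j - k - 1` of them are not to the right of `a`. At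
      -- least `j + k` of the `2 * (m - a) - 2` chips there are then in `O`.
      have h10 : rightCount Z a x ≤ 2 * (m - a) - j - k - 2 := by omega
      have e6 := siteCount_eq_rightCount Z (a + 1) y
      rw [add_sub_cancel_right] at e6
      have h11 := rightCount_anti Z x (show a ≤ a + 1 by omega)
      rw [if_pos rfl]
      exact ⟨by omega, fun _ => ⟨by omega, by omega⟩⟩
    -- A chip of `O` takes part, so the excess of `Z` at `a` does not grow. Twice it equals the
    -- excesses at `a` and `a + 1` plus `rightCount Z a`.
    · left
      rw [e3, e3, e1, e1, e2]
      rw [if_neg (by omega), if_neg (by omega), if_pos rfl, if_neg (by omega)]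
      omega
    · left
      rw [e3, e3, e1, e1, e2]
      rw [if_neg (by omega), if_pos rfl, if_neg (by omega), if_neg (by omega), if_neg (by omega)]
      omega
  | succ q hq ih =>
    intro hq' y hy
    obtain ⟨x, hx, hf⟩ := hy.exists_fire hd hN h0 (by omega) (by omega)
    have h3 := hx.siteCount_eq_three h0 hkm (by omega) (by omega)
    have h6 := rightCount_anti O x (show q ≤ q + 1 by omega)
    have h7 := siteCount_eq_rightCount O q x
    have h8 := siteCount_eq_rightCount Z q x
    have n2 := excess_nonneg Z (m - k - 1) y
    have h9 := siteCount_nonneg Z q x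
    have h10 := siteCount_nonneg O q x
    rw [add_sub_cancel_right]
    rcases ih (by omega) x hx with ⟨i1, i2, i3⟩ | ⟨i1, i2⟩
    · left
      rcases hf.effect_three hd h3 with ⟨g, e1, e2, e3⟩ | ⟨g, e1, e2, e3⟩ | ⟨g, g', e1, e2, e3⟩
      · omega
      · rw [e3, e3, e1, e1, e2, if_neg (by omega), if_neg (by omega), if_pos rfl,
          if_neg (by omega)]
        omega
      -- Twice the excess drops by two, while at most two chips of `Z` at `q` leave the count on the
      -- right-hand side.
      · have e4 := e1 a
        have e5 := e1 (m - k - 1)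
        rw [if_pos (by omega)] at e4
        rw [if_neg (by omega)] at e5
        rw [e3, e3, e2, if_neg (by omega), if_pos rfl, if_neg (by omega)]
        omega
    · right
      rw [if_neg (by omega : ¬ q + 1 = a + 1)]
      refine ⟨?_, fun h => by omega⟩
      -- When `q = a + 1`, a chip of `Z` is known to be there, so the firing sends one back to `a`
      -- and cancels the extra `1`. Later firings do not affect the count at `a`.
      rcases hf.effect_three hd h3 with ⟨g, e1, e2, e3⟩ | ⟨g, e1, e2, e3⟩ | ⟨g, g', e1, e2, e3⟩ <;>
        rw [e2] <;> split_ifs at i1 ⊢ <;> omega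

theorem quarterSq_mean {e X : ℤ} (h : 2 * e ≤ quarterSq X + quarterSq (X - 2)) :
    e ≤ quarterSq (X - 1) := by
  have h1 := quarterSq_diff (X - 2)
  have h2 := quarterSq_diff (X - 1)
  rw [show X - 2 + 1 = X - 1 by ring] at h1
  rw [show X - 1 + 1 = X by ring] at h2
  omega

theorem quarterSq_add_two {X : ℤ} (h : 2 ≤ X) :
    quarterSq (X - 3) + (X - 2) = quarterSq (X - 1) := by
  have h1 := quarterSq_diff (X - 2)
  have h2 := quarterSq_diff (X - 3)
  rw [show X - 2 + 1 = X - 1 by ring] at h1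
  rw [show X - 3 + 1 = X - 2 by ring] at h2
  omega

/-- Induction on `a` from right to left. With `X = 2 * (m - a) - j - k`, a carried chip of `O` gives
the mean of the quarter squares of `X` and `X - 2`. Otherwise the new bound at `a + 1` plus the at
most `X - 2` chips of `Z` right of `a` gives exactly `quarterSq (X - 1)`. -/
theorem SweepBound.succ (hd : Disjoint Z O) (hN : (Z.card : ℤ) + O.card = 4 * m - 1)
    (hO : (O.card : ℤ) ≤ 2 * j) (hO' : 2 * j - 1 ≤ (O.card : ℤ)) (hj : j ≤ m)
    (h0 : 0 ≤ k) (hk : k < j) (hb : SweepBound m j Z O k) : SweepBound m j Z O (k + 1) := by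
  intro y hy
  rw [AtSweep.next h0 (by omega)] at hy
  have far : ∀ a, m - k ≤ a → excess Z a y ≤ quarterSq (2 * (m - a) - j - (k + 1)) := by
    intro a ha
    have h1 := hb.before hd hN h0 (by omega) le_rfl y hy a (by omega) ha
    rw [quarterSq_of_le_one (by omega)] at h1
    exact h1.trans (quarterSq_nonneg _)
  have near : ∀ n : ℕ, m - j ≤ m - k - n →
      excess Z (m - k - n) y ≤ quarterSq (2 * (m - (m - k - n)) - j - (k + 1)) := by
    intro n
    induction n with
    | zero => intro _; exact far _ (by simp)
    | succ n ih =>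
      intro hn
      set a : ℤ := m - k - (n + 1 : ℕ) with ha
      have ha1 : m - k - (n : ℤ) = a + 1 := by push_cast at ha; omega
      rw [ha1] at ih
      have h1 := ih (by omega)
      have r := rightCount_eq Z a y
      have nz := rightCount_nonneg Z a y
      rw [show 2 * (m - a) - j - (k + 1) = (2 * (m - a) - j - k) - 1 by ring]
      rw [show 2 * (m - (a + 1)) - j - (k + 1) = (2 * (m - a) - j - k) - 3 by ring] at h1
      rcases hb.after hd hN hO hO' hj h0 hk hn (by omega) (by omega) le_rfl y hy with
        ⟨_, i2, i3⟩ | ⟨i1, i2⟩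
      · refine quarterSq_mean ?_
        have r' := rightCount_eq Z (m - k - 1) y
        have := excess_nonneg Z (m - k - 1 + 1) y
        have := rightCount_nonneg Z (m - k - 1) y
        omega
      · rw [if_neg fun h => by have := i2 h; omega] at i1
        have := quarterSq_add_two (X := 2 * (m - a) - j - k) (by omega)
        omega
  intro a ha
  rcases le_or_gt (m - k) a with h | h
  · exact far a h
  · have := near (m - k - a).toNat
    rw [Int.toNat_of_nonneg (by omega), show m - k - (m - k - a) = a by ring] at this
    exact this ha

theorem sweepBound (hd : Disjoint Z O) (hN : (Z.card : ℤ) + O.card = 4 * m - 1)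
    (hO : (O.card : ℤ) ≤ 2 * j) (hO' : 2 * j - 1 ≤ (O.card : ℤ)) (hj : j ≤ m)
    (h0 : 0 ≤ k) : k ≤ j → SweepBound m j Z O k := by
  induction k, h0 using Int.leInduction with
  | base =>
    intro _ x hx a ha
    have := excess_le_quarterSq hd (h := 2 * m - j) (by omega) hx.1 a
    rwa [show 2 * (m - a) - j - 0 = 2 * m - j - 2 * a by ring]
  | succ k h0 ih =>
    intro hk
    exact (ih (by omega)).succ hd hN hO hO' hj h0 (by omega)

/-- Every configuration with no remaining firings is reached through the end of sweep `k - 1`. -/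
theorem exists_atSweep (hd : Disjoint Z O) (hm : 1 ≤ m)
    (hN : (Z.card : ℤ) + O.card = 4 * m - 1) (h0 : 0 ≤ k) (hk : k ≤ m) {x : ι → ℤ}
    (hx : Reach Z O x) (hr : ∀ p, remaining m Z O x p = 0) :
    ∃ w, AtSweep m Z O k (-k) w ∧
      Relation.ReflTransGen (LateFire m Z O (sweepCut m k (-k))) w x := by
  obtain ⟨w, hw, hr', hl⟩ := (isCut_sweepCut (q := -k) h0 (by omega)).exists_state
    hd hm hN hx
  refine ⟨w, ⟨hw, fun p => ?_⟩, hl⟩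
  rw [hr', hr]
  unfold sweepCut
  split_ifs <;> omega

/-- Since `R a ≤ 0`, the site `a` never fires again, and no other firing raises this excess. -/
theorem LateFire.excess_le {R : ℤ → ℤ} (hd : Disjoint Z O) (hm : 1 ≤ m)
    (hN : (Z.card : ℤ) + O.card = 4 * m - 1) {a : ℤ} (ha : R a ≤ 0) {w x : ι → ℤ}
    (h : Relation.ReflTransGen (LateFire m Z O R) w x) : excess Z a x ≤ excess Z a w := by
  induction h with
  | refl => exact le_rfl
  | tail _ h ih =>
    obtain ⟨hu, q, hq, hf⟩ := h
    have hn := remaining_nonneg hd hm hN (hu.fire hf) q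
    rw [remaining_fire hd hf, if_pos rfl] at hn
    have hne : a ≠ q := by rintro rfl; omega
    rcases hf.effect hd with ⟨_, e, _⟩ | ⟨_, _, e⟩ | ⟨_, _, _, e, _⟩ <;> rw [e]
    · rw [if_neg hne]; omega
    · exact ih
    · split_ifs <;> omega

theorem LateFire.rightCount_le {R : ℤ → ℤ} (hd : Disjoint Z O) (hm : 1 ≤ m)
    (hN : (Z.card : ℤ) + O.card = 4 * m - 1) {a : ℤ} (ha : R a ≤ 0) {w x : ι → ℤ}
    (h : Relation.ReflTransGen (LateFire m Z O R) w x) : rightCount Z a x ≤ rightCount Z a w := by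
  induction h with
  | refl => exact le_rfl
  | tail _ h ih =>
    obtain ⟨hu, q, hq, hf⟩ := h
    have hn := remaining_nonneg hd hm hN (hu.fire hf) q
    rw [remaining_fire hd hf, if_pos rfl] at hn
    have hne : a ≠ q := by rintro rfl; omega
    rw [rightCount_eq] at ih ⊢
    rcases hf.effect hd with ⟨_, e, _⟩ | ⟨_, _, e⟩ | ⟨_, _, _, e, _⟩ <;> rw [e, e]
    · split_ifs <;> omega
    · exact ih
    · split_ifs <;> omega

/-- If there are `2 * j - 1` or `2 * j` chips of `O`, at the end the chips of `Z` are at most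
at `m - j`. -/
theorem le_of_final (hd : Disjoint Z O) (hN : (Z.card : ℤ) + O.card = 4 * m - 1)
    (hO : (O.card : ℤ) ≤ 2 * j) (hO' : 2 * j - 1 ≤ (O.card : ℤ)) (hj1 : 1 ≤ j) (hj : j ≤ m)
    {x : ι → ℤ} (hx : Reach Z O x) (hf : ∀ p, siteCount Z p x + siteCount O p x ≤ 2) :
    ∀ i ∈ Z, x i ≤ m - j := by
  have hr := remaining_eq_zero_of_final hd (by omega) hN hx hf
  obtain ⟨w, hw, hl⟩ := exists_atSweep hd (by omega) hN (by omega : 0 ≤ j) hj hx hr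
  have h1 := sweepBound hd hN hO hO' hj (by omega) le_rfl w hw (m - j) le_rfl
  rw [quarterSq_of_le_one (by omega)] at h1
  have h2 := LateFire.excess_le hd (by omega) hN (a := m - j)
    (by unfold sweepCut; split_ifs <;> omega) hl
  have h3 := excess_nonneg Z (m - j) x
  exact (excess_eq_zero_iff Z (m - j) x).mp (by omega)

/-- If there are `2 * j` chips of `O`, after sweep `j` at most one chip of `Z` is right of
`m - j - 1`. -/
theorem rightCount_le_one (hd : Disjoint Z O) (hN : (Z.card : ℤ) + O.card = 4 * m - 1)
    (hO : (O.card : ℤ) = 2 * j) (hj1 : 1 ≤ j) (hj : j < m) {q : ℤ} (hq : -j ≤ q) :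
    q ≤ m - j → ∀ x, AtSweep m Z O j q x → rightCount Z (m - j - 1) x ≤ 1 ∧
      excess Z (m - j) x = 0 := by
  induction q, hq using Int.leInduction with
  | base =>
    intro _ x hx
    have h1 := sweepBound hd hN (by omega) (by omega) hj.le (by omega) le_rfl x hx (m - j) le_rfl
    rw [quarterSq_of_le_one (by omega)] at h1
    have h2 := excess_nonneg Z (m - j) x
    have h3 := rightCount_eq Z (m - j) x
    have h4 := excess_nonneg Z (m - j + 1) x
    have h5 := siteCount_eq_rightCount Z (m - j) x
    have h6 := siteCount_nonneg O (m - j) x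
    have h7 := siteCount_add (m := m) (Z := Z) (O := O) (by omega) x (m - j)
    rw [hx.2, hx.2, hx.2] at h7
    have r0 : sweepCut m j (-j) (m - j) = 0 := by unfold sweepCut; split_ifs <;> omega
    have r1 : sweepCut m j (-j) (m - j - 1) = 1 := by unfold sweepCut; split_ifs <;> omega
    have r2 : sweepCut m j (-j) (m - j + 1) = 0 := by unfold sweepCut; split_ifs <;> omega
    have r3 := finalRight_diff_le (m := m) (by omega) (m - j)
    omega
  | succ q hq ih =>
    intro hq' y hy
    obtain ⟨x, hx, hf⟩ := hy.exists_fire hd hN (by omega) hq (by omega)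
    have h3 := hx.siteCount_eq_three (by omega) hj hq (by omega)
    have h4 := AtSweep.carry hd hN hO.le (by omega) hj hq (by omega) x hx
    have h7 := siteCount_eq_rightCount O q x
    have h8 := siteCount_nonneg Z q x
    have h9 := ih (by omega) x hx
    have h10 := excess_nonneg Z (m - j) y
    rcases hf.effect_three hd h3 with ⟨g, e1, e2, e3⟩ | ⟨g, e1, e2, e3⟩ | ⟨g, g', e1, e2, e3⟩
    · rw [e1, e2, if_neg (by omega : ¬ m - j - 1 = q - 1), if_neg (by omega : ¬ m - j = q)]
      split_ifs with e
      -- A firing of chips of `Z` alone at `m - j - 1` means that no chip of `O` was met and none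
      -- was left behind. All `2 * j` of them then fill the places to the right, and the chip of `Z`
      -- that arrives is the first.
      · have h11 := hx.rightCount_add (a := m - j - 1) (by omega) hj (by omega) (by omega)
          (by omega)
        rw [← e] at h4 h7 g
        have h12 := rightCount_nonneg Z (m - j - 1) x
        omega
      · omega
    · rw [e1, e2]; exact h9
    · rw [e1] at h10 ⊢
      rw [e2]
      split_ifs at h10 ⊢ <;> omega

/-- If there are `2 * j` chips of `O`, at the end they are at least at `m - j`. -/
theorem ge_of_final (hd : Disjoint Z O) (hN : (Z.card : ℤ) + O.card = 4 * m - 1)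
    (hO : (O.card : ℤ) = 2 * j) (hj1 : 1 ≤ j) (hj : j ≤ m)
    {x : ι → ℤ} (hx : Reach Z O x) (hf : ∀ p, siteCount Z p x + siteCount O p x ≤ 2) :
    ∀ i ∈ O, m - j ≤ x i := by
  rcases hj.lt_or_eq with hj | rfl
  · have hr := remaining_eq_zero_of_final hd (by omega) hN hx hf
    obtain ⟨w, hw, hl⟩ := exists_atSweep hd (by omega) hN (k := j + 1) (by omega) (by omega) hx hr
    rw [AtSweep.next (by omega) hj] at hw
    have h1 := (rightCount_le_one hd hN hO hj1 hj (by omega) le_rfl w hw).1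
    have h2 := LateFire.rightCount_le hd (by omega) hN (a := m - j - 1)
      (by unfold sweepCut; split_ifs <;> omega) hl
    have h3 := rightCount_add (m := m) (Z := Z) (O := O) (by omega) x (m - j - 1)
    rw [hr, hr] at h3
    have h4 := rightCount_le_card O (m - j - 1) x
    have h5 : rightCount O (m - j - 1) x = O.card := by
      unfold finalRight at h3
      split_ifs at h3 <;> omega
    intro i hi
    unfold rightCount at h5
    have h6 := Finset.eq_of_subset_of_card_le
      (Finset.filter_subset (fun i => m - j - 1 < x i) O) (by omega)
    rw [← h6, Finset.mem_filter] at hi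
    omega
  -- For `j = m` no sweep is left, but `Z` has `2 * m - 1` chips, so the reflected bound for `O`
  -- applies.
  · intro i hi
    have := le_of_final hd.symm (m := j) (j := j) (by omega) (by omega) (by omega) hj1 le_rfl
      (hx.mirror hd) (fun p => by rw [siteCount_neg, siteCount_neg, add_comm]; exact hf _) i hi
    rw [Pi.neg_apply] at this
    omega

end Sweep

/-! ### From labels to two kinds of chips. -/

section Labels

variable {n : ℕ} {lab lab' : Fin n → ℤ} {S : Set (Fin n)}

theorem update_eq_move (x : Config n) {a c : Fin n} (hac : a ≠ c) :
    Function.update (Function.update x a (x a - 1)) c (x c + 1) =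
      x + Pi.single c 1 - Pi.single a 1 := by
  ext i
  simp only [Function.update_apply, Pi.sub_apply, Pi.add_apply, Pi.single_apply]
  by_cases h1 : i = c
  · subst h1; simp [hac.symm]
  · by_cases h2 : i = a
    · subst h2; simp [h1]
    · simp [h1, h2]

/-- Forgetting all label comparisons except those across an upward closed class `O` keeps every move
legal. -/
theorem FiresIn.fire {Z O : Finset (Fin n)} (hS : ∀ i ∈ S, i ∈ Z ∪ O)
    (hO : ∀ i ∈ S, ∀ k ∈ S, lab i ≤ lab k → i ∈ O → k ∈ O) {x y : Config n}
    (h : FiresIn lab S x y) : ∃ p, Fire Z O p x y := by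
  obtain ⟨a, ha, b, hb, c, hc, hab, hbc, hac, h1, h2, h3, h4, rfl⟩ := h
  exact ⟨x a, a, b, c, hS a ha, hS b hb, hS c hc, hab, hbc, hac, rfl, h1.symm,
    (h1.trans h2).symm, hO a ha b hb h3, hO b hb c hc h4, update_eq_move x hac⟩

theorem ReachesIn.reach {Z O : Finset (Fin n)} (hS : ∀ i ∈ S, i ∈ Z ∪ O)
    (hO : ∀ i ∈ S, ∀ k ∈ S, lab i ≤ lab k → i ∈ O → k ∈ O) {x : Config n}
    (h : ReachesIn lab S (allAtOrigin n) x) : Reach Z O x :=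
  Relation.ReflTransGen.mono (fun _ _ h => h.fire hS hO) _ _ h

theorem FiresIn.mono (hl : ∀ a b, lab a ≤ lab b → lab' a ≤ lab' b) {T : Set (Fin n)} (hS : S ⊆ T)
    {x y : Config n} (h : FiresIn lab S x y) : FiresIn lab' T x y := by
  obtain ⟨a, ha, b, hb, c, hc, hab, hbc, hac, h1, h2, h3, h4, h5⟩ := h
  exact ⟨a, hS ha, b, hS hb, c, hS hc, hab, hbc, hac, h1, h2, hl _ _ h3, hl _ _ h4, h5⟩

theorem ReachesIn.mono (hl : ∀ a b, lab a ≤ lab b → lab' a ≤ lab' b) {T : Set (Fin n)}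
    (hS : S ⊆ T) {x y : Config n} (h : ReachesIn lab S x y) : ReachesIn lab' T x y :=
  Relation.ReflTransGen.mono (fun _ _ h => h.mono hl hS) _ _ h

/-- Three chips at one site can be fired. -/
theorem exists_firesIn (lab : Fin n → ℤ) {x : Config n} {a b c : Fin n} (ha : a ∈ S) (hb : b ∈ S)
    (hc : c ∈ S) (hab : a ≠ b) (hbc : b ≠ c) (hac : a ≠ c) (h1 : x a = x b) (h2 : x b = x c) :
    ∃ y, FiresIn lab S x y := by
  have key : ∀ a ∈ S, ∀ b ∈ S, ∀ c ∈ S, a ≠ b → b ≠ c → a ≠ c → x a = x b → x b = x c →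
      lab a ≤ lab b → lab b ≤ lab c → ∃ y, FiresIn lab S x y :=
    fun a ha b hb c hc hab hbc hac h1 h2 h3 h4 =>
      ⟨_, a, ha, b, hb, c, hc, hab, hbc, hac, h1, h2, h3, h4, rfl⟩
  have h3 := h1.trans h2
  rcases le_total (lab a) (lab b) with g1 | g1 <;> rcases le_total (lab b) (lab c) with g2 | g2 <;>
    rcases le_total (lab a) (lab c) with g3 | g3
  · exact key a ha b hb c hc hab hbc hac h1 h2 g1 g2
  · exact key a ha b hb c hc hab hbc hac h1 h2 g1 g2
  · exact key a ha c hc b hb hac hbc.symm hab h3 h2.symm g3 g2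
  · exact key c hc a ha b hb hac.symm hab hbc.symm h3.symm h1 g3 g1
  · exact key b hb a ha c hc hab.symm hac hbc h1.symm h3 g1 g3
  · exact key b hb c hc a ha hbc hac.symm hab.symm h2 h3.symm g2 g3
  · exact key c hc b hb a ha hbc.symm hab.symm hac.symm h2.symm h1.symm g2 g1
  · exact key c hc b hb a ha hbc.symm hab.symm hac.symm h2.symm h1.symm g2 g1

theorem FinalIn.congr (lab' : Fin n → ℤ) {x : Config n} (h : FinalIn lab S x) :
    FinalIn lab' S x := by
  rintro y ⟨a, ha, b, hb, c, hc, hab, hbc, hac, h1, h2, -⟩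
  obtain ⟨z, hz⟩ := exists_firesIn lab ha hb hc hab hbc hac h1 h2
  exact h z hz

theorem FinalIn.siteCount_le {A : Finset (Fin n)} (hA : ∀ i ∈ A, i ∈ S) {x : Config n}
    (h : FinalIn lab S x) (p : ℤ) : siteCount A p x ≤ 2 := by
  unfold siteCount
  by_contra hcon
  obtain ⟨a, b, c, ha, hb, hc, hab, hac, hbc⟩ := Finset.two_lt_card_iff.mp
    (show 2 < (A.filter fun i => x i = p).card by omega)
  rw [Finset.mem_filter] at ha hb hc
  obtain ⟨z, hz⟩ := exists_firesIn lab (hA a ha.1) (hA b hb.1) (hA c hc.1) hab hbc hac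
    (ha.2.trans hb.2.symm) (hb.2.trans hc.2.symm)
  exact h z hz

/-- Since positions stay bounded, the constant growth forces termination. -/
theorem FiresIn.sum_sq {x y : Config n} (h : FiresIn lab S x y) :
    ∑ i, y i ^ 2 = ∑ i, x i ^ 2 + 2 := by
  obtain ⟨a, -, b, -, c, -, -, -, hac, h1, h2, -, -, rfl⟩ := h
  have h3 := h1.trans h2
  rw [update_eq_move x hac]
  have : ∀ i ∈ Finset.univ, (x + Pi.single c 1 - Pi.single a 1 : Config n) i ^ 2 =
      x i ^ 2 + (if i = c then 2 * x a + 1 else 0) + (if i = a then -2 * x a + 1 else 0) := by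
    intro i _
    simp only [Pi.sub_apply, Pi.add_apply, Pi.single_apply]
    by_cases h1 : i = c
    · subst h1; simp only [if_true, hac.symm, if_false, h3]; ring
    · by_cases h2 : i = a
      · subst h2; simp only [if_true, if_neg hac]; ring
      · simp [h1, h2]
  rw [Finset.sum_congr rfl this, Finset.sum_add_distrib, Finset.sum_add_distrib]
  simp only [Finset.sum_ite_eq', Finset.mem_univ, if_true]
  ring

end Labels

/-! ### The doubled labels: sorting in the first phase, and its failure at the end. -/

section Double

variable {m : ℕ}

/-- With all chips in one class and `h = 2m + 1`, the quarter-square bound at `m` is `quarterSq 1 =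
0`; reflection gives the other side. -/
theorem Reaches.abs_le {lab : Fin (4 * m + 1) → ℤ} {x : Config (4 * m + 1)}
    (h : Reaches lab (allAtOrigin _) x) (i : Fin (4 * m + 1)) : -(m : ℤ) ≤ x i ∧ x i ≤ m := by
  have key : ∀ z : Config (4 * m + 1), Reach Finset.univ ∅ z → z i ≤ m := by
    intro z hz
    have h1 := excess_le_quarterSq (by simp) (h := 2 * m + 1) (by simp; omega) hz m
    rw [quarterSq_of_le_one (by omega)] at h1
    exact (excess_eq_zero_iff _ _ _).mp (le_antisymm h1 (excess_nonneg _ _ _)) i (by simp)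
  have h1 := key x (ReachesIn.reach (by simp) (by simp) h)
  have h2 : Reach ∅ Finset.univ x := ReachesIn.reach (by simp) (by simp) h
  have h3 := key _ (h2.mirror (by simp))
  rw [Pi.neg_apply] at h3
  omega

theorem exists_final (lab : Fin (4 * m + 1) → ℤ) (S : Set (Fin (4 * m + 1)))
    {x : Config (4 * m + 1)} (hx : Reaches lab (allAtOrigin _) x) :
    ∃ y, ReachesIn lab S x y ∧ FinalIn lab S y := by
  have key : ∀ N : ℕ, ∀ x, Reaches lab (allAtOrigin _) x →
      ∑ i : Fin (4 * m + 1), (m : ℤ) ^ 2 - ∑ i, x i ^ 2 ≤ N →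
      ∃ y, ReachesIn lab S x y ∧ FinalIn lab S y := by
    intro N
    induction N with
    | zero =>
      intro x hx hN
      refine ⟨x, .refl, fun y hy => ?_⟩
      have h1 := hy.sum_sq
      have hy' : Reaches lab (allAtOrigin _) y :=
        Relation.ReflTransGen.tail hx (hy.mono (fun _ _ => id) (Set.subset_univ S))
      have h2 : ∑ i, y i ^ 2 ≤ ∑ i : Fin (4 * m + 1), (m : ℤ) ^ 2 :=
        Finset.sum_le_sum fun i _ => by have := hy'.abs_le i; nlinarith
      push_cast at hN
      omega
    | succ N ih =>
      intro x hx hN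
      by_cases hf : FinalIn lab S x
      · exact ⟨x, .refl, hf⟩
      · unfold FinalIn at hf
        push Not at hf
        obtain ⟨y, hy⟩ := hf
        have h1 := hy.sum_sq
        obtain ⟨z, hz, hz'⟩ := ih y
          (Relation.ReflTransGen.tail hx (hy.mono (fun _ _ => id) (Set.subset_univ S)))
          (by push_cast at hN; omega)
        exact ⟨z, Relation.ReflTransGen.head hy hz, hz'⟩
  exact key _ x hx (Int.self_le_toNat _)

theorem doubleLabel_mono {i k : Fin (4 * m + 1)} (h : i ≤ k) :
    doubleLabel m i ≤ doubleLabel m k := by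
  have h' : (i : ℕ) ≤ k := h
  unfold doubleLabel
  split_ifs <;> omega

theorem mem_unheld (hm : 1 ≤ m) (i : Fin (4 * m + 1)) : i ∈ unheld m ↔ 2 ≤ (i : ℕ) := by
  unfold unheld doubleLabel
  rw [Set.mem_ofPred_eq]
  split_ifs <;> omega

theorem card_filter_fin {n a b : ℕ} (hb : b ≤ n) (P : Fin n → Prop) [DecidablePred P]
    (h : ∀ i, P i ↔ a ≤ (i : ℕ) ∧ (i : ℕ) < b) : (Finset.univ.filter P).card = b - a := by
  rw [← Nat.card_Ico, ← Finset.card_map Fin.valEmbedding]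
  congr 1
  ext k
  simp only [Finset.mem_map, Finset.mem_filter, Finset.mem_univ, true_and, h,
    Fin.valEmbedding_apply, Finset.mem_Ico]
  constructor
  · rintro ⟨i, hi, rfl⟩; exact hi
  · intro hk; exact ⟨⟨k, by omega⟩, hk, rfl⟩

open Classical in
/-- The chips that are not held and whose label is less than `θ`. -/
noncomputable def lowChips (m : ℕ) (θ : ℤ) : Finset (Fin (4 * m + 1)) :=
  Finset.univ.filter fun i => i ∈ unheld m ∧ doubleLabel m i < θ

open Classical in
/-- The chips that are not held and whose label is at least `θ`. -/
noncomputable def highChips (m : ℕ) (θ : ℤ) : Finset (Fin (4 * m + 1)) :=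
  Finset.univ.filter fun i => i ∈ unheld m ∧ θ ≤ doubleLabel m i

theorem disjoint_chips (m : ℕ) (θ : ℤ) : Disjoint (lowChips m θ) (highChips m θ) := by
  rw [Finset.disjoint_left]
  intro i h1 h2
  simp only [lowChips, highChips, Finset.mem_filter] at h1 h2
  omega

theorem mem_chips (m : ℕ) (θ : ℤ) (i : Fin (4 * m + 1)) :
    i ∈ lowChips m θ ∪ highChips m θ ↔ i ∈ unheld m := by
  simp only [Finset.mem_union, lowChips, highChips, Finset.mem_filter, Finset.mem_univ, true_and]
  have := lt_or_ge (doubleLabel m i) θ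
  tauto

theorem card_chips (hm : 1 ≤ m) (θ : ℤ) :
    ((lowChips m θ).card : ℤ) + (highChips m θ).card = 4 * m - 1 := by
  classical
  have h1 : (lowChips m θ ∪ highChips m θ).card = 4 * m + 1 - 2 := by
    have h2 : lowChips m θ ∪ highChips m θ = Finset.univ.filter fun i => i ∈ unheld m := by
      ext i
      rw [mem_chips, Finset.mem_filter]
      simp
    rw [h2]
    refine card_filter_fin le_rfl _ fun i => ?_
    rw [mem_unheld hm]
    omega
  rw [Finset.card_union_of_disjoint (disjoint_chips m θ)] at h1
  omega

theorem card_highChips (hm : 1 ≤ m) {θ : ℤ} (h1 : 1 ≤ θ) (h2 : θ ≤ m) :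
    ((highChips m θ).card : ℤ) = 2 * (m - θ + 1) := by
  classical
  have h3 : (highChips m θ).card = 4 * m + 1 - (2 * (m + θ) - 1).toNat := by
    unfold highChips
    refine card_filter_fin le_rfl _ fun i => ?_
    rw [mem_unheld hm]
    unfold doubleLabel
    split_ifs <;> omega
  omega

theorem card_lowChips (hm : 1 ≤ m) {θ : ℤ} (h1 : -m < θ) (h2 : θ ≤ 0) :
    ((lowChips m θ).card : ℤ) = 2 * (m + θ - 1) := by
  classical
  have h3 : (lowChips m θ).card = (2 * (m + θ)).toNat - 2 := by
    unfold lowChips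
    refine card_filter_fin (by omega) _ fun i => ?_
    rw [mem_unheld hm]
    unfold doubleLabel
    split_ifs <;> omega
  omega

theorem neg_le_doubleLabel (i : Fin (4 * m + 1)) : -(m : ℤ) ≤ doubleLabel m i := by
  unfold doubleLabel
  split_ifs <;> omega

theorem doubleLabel_le (i : Fin (4 * m + 1)) : doubleLabel m i ≤ m := by
  unfold doubleLabel
  split_ifs <;> omega

theorem reach_chips {s : Config (4 * m + 1)}
    (hs : ReachesIn (doubleLabel m) (unheld m) (allAtOrigin _) s) (θ : ℤ) :
    Reach (lowChips m θ) (highChips m θ) s := by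
  refine hs.reach (fun i hi => (mem_chips m θ i).mpr hi) fun i _ k hk hik hi => ?_
  simp only [highChips, Finset.mem_filter, Finset.mem_univ, true_and] at hi ⊢
  exact ⟨hk, hi.2.trans hik⟩

theorem siteCount_chips {s : Config (4 * m + 1)} (hf : FinalIn (doubleLabel m) (unheld m) s)
    (θ p : ℤ) : siteCount (lowChips m θ) p s + siteCount (highChips m θ) p s ≤ 2 := by
  rw [← siteCount_union (disjoint_chips m θ)]
  exact hf.siteCount_le (fun i hi => (mem_chips m θ i).mp hi) p

/-- Chips that are fired among themselves until no further move is possible become sorted if the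
two chips with the smallest label are held. -/
theorem weaklySortedOn_of_final (hm : 1 ≤ m) {s : Config (4 * m + 1)}
    (hs : ReachesIn (doubleLabel m) (unheld m) (allAtOrigin _) s)
    (hf : FinalIn (doubleLabel m) (unheld m) s) :
    WeaklySortedOn (doubleLabel m) (unheld m) s := by
  intro a ha b hb hab
  set θ := doubleLabel m b with hθ
  have hd := disjoint_chips m θ
  have hN := card_chips hm θ
  have hr := reach_chips hs θ
  have hc := siteCount_chips hf θ
  have haZ : a ∈ lowChips m θ := by simp [lowChips, ha, hab]
  have hbO : b ∈ highChips m θ := by simp [highChips, hb, hθ]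
  have hb' := doubleLabel_le b
  have ha' := neg_le_doubleLabel a
  have ha'' : doubleLabel m a ≠ -(m : ℤ) := ha
  -- In both cases the bounds for the two classes meet at the site `θ - 1`. For `θ ≤ 0` it is the
  -- low class without the held chips that has even size, so the picture is reflected.
  rcases le_or_gt 1 θ with h | h
  · have hO := card_highChips hm h hb'
    have h1 := le_of_final hd hN (j := m - θ + 1) hO.le (by omega) (by omega) (by omega) hr hc a haZ
    have h2 := ge_of_final hd hN hO (by omega) (by omega) hr hc b hbO
    omega
  · have hZ := card_lowChips hm (θ := θ) (by omega) (by omega)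
    have hr' := hr.mirror hd
    have hc' : ∀ p, siteCount (highChips m θ) p (-s) + siteCount (lowChips m θ) p (-s) ≤ 2 := by
      intro p
      rw [siteCount_neg, siteCount_neg, add_comm]
      exact hc _
    have hN' := (add_comm _ _).trans hN
    have h1 := le_of_final hd.symm hN' (j := m + θ - 1) hZ.le (by omega) (by omega) (by omega)
      hr' hc' b hbO
    have h2 := ge_of_final hd.symm hN' hZ (by omega) (by omega) hr' hc' a haZ
    rw [Pi.neg_apply] at h1 h2
    omega

/-- A chip that is not held ends up at `-m`. -/
theorem exists_unheld_at (hm : 1 ≤ m) {s : Config (4 * m + 1)}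
    (hs : ReachesIn (doubleLabel m) (unheld m) (allAtOrigin _) s)
    (hf : FinalIn (doubleLabel m) (unheld m) s) : ∃ i ∈ unheld m, s i = -(m : ℤ) := by
  have hm' : (1 : ℤ) ≤ m := by omega
  -- The threshold `0` is arbitrary: only the union of the two classes matters.
  have hd := disjoint_chips m 0
  have hr := remaining_eq_zero_of_final hd hm' (card_chips hm 0) (reach_chips hs 0)
    (siteCount_chips hf 0)
  have h1 := siteCount_add (m := m) (Z := lowChips m 0) (O := highChips m 0) hm' s (-m)
  rw [hr, hr, hr, ← siteCount_union hd] at h1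
  have h2 : 0 < siteCount (lowChips m 0 ∪ highChips m 0) (-m) s := by
    rw [h1]
    unfold finalRight
    split_ifs <;> omega
  unfold siteCount at h2
  obtain ⟨i, hi⟩ := Finset.card_pos.mp (Int.natCast_pos.mp h2)
  rw [Finset.mem_filter, mem_chips] at hi
  exact ⟨i, hi⟩

/-- A chip at `-m` never moves again. -/
theorem Reaches.stays {lab : Fin (4 * m + 1) → ℤ} {s t : Config (4 * m + 1)}
    (hs : Reaches lab (allAtOrigin _) s) (h : Reaches lab s t) {i : Fin (4 * m + 1)}
    (hi : s i = -(m : ℤ)) : t i = -(m : ℤ) := by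
  induction h with
  | refl => exact hi
  | @tail x y hx hxy ih =>
    have hy : Reaches lab (allAtOrigin _) y := (hs.trans hx).tail hxy
    obtain ⟨a, -, b, -, c, -, -, -, hac, h1, h2, -, -, rfl⟩ := hxy
    rw [update_eq_move x hac] at hy ⊢
    -- A firing at `-m` would send a chip to `-m - 1`, so the fired site is another one.
    have ha := (hy.abs_le a).1
    simp only [Pi.sub_apply, Pi.add_apply, Pi.single_apply, if_true, hac, if_false] at ha ⊢
    split_ifs with e1 e2 e2
    · exact absurd (e1.symm.trans e2) hac.symm
    · subst e1; omega
    · subst e2; omega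
    · omega

/-- An unheld chip is stuck at `-m`. Sortedness would force both held chips, whose label is smaller,
onto the same site, where the three could still fire. -/
theorem not_weaklySorted_of_final (hm : 1 ≤ m) {s t : Config (4 * m + 1)}
    (hs : ReachesIn (doubleLabel m) (unheld m) (allAtOrigin _) s)
    (hf : FinalIn (doubleLabel m) (unheld m) s) (ht : Reaches (doubleLabel m) s t)
    (hft : Final (doubleLabel m) t) : ¬ WeaklySorted (doubleLabel m) t := by
  intro hsort
  have hs' : Reaches (doubleLabel m) (allAtOrigin _) s :=
    hs.mono (fun _ _ => id) (Set.subset_univ _)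
  obtain ⟨i, hi, hsi⟩ := exists_unheld_at hm hs hf
  have hti := hs'.stays ht hsi
  have held : ∀ k : Fin (4 * m + 1), (k : ℕ) < 2 → t k = -(m : ℤ) := by
    intro k hk
    have h1 : doubleLabel m k = -(m : ℤ) := by
      by_contra h
      have := (mem_unheld hm k).mp h
      omega
    have h2 : doubleLabel m i ≠ -(m : ℤ) := hi
    have h3 := neg_le_doubleLabel i
    have h4 := hsort k (Set.mem_univ _) i (Set.mem_univ _) (by omega)
    have h5 := (Reaches.abs_le (hs'.trans ht) k).1
    omega
  have hi2 := (mem_unheld hm i).mp hi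
  have h0 := held ⟨0, by omega⟩ (by simp)
  have h1 := held ⟨1, by omega⟩ (by simp)
  obtain ⟨y, hy⟩ := exists_firesIn (S := Set.univ) (doubleLabel m) (x := t)
    (a := ⟨0, by omega⟩) (b := ⟨1, by omega⟩) (c := i) (Set.mem_univ _) (Set.mem_univ _)
    (Set.mem_univ _) (by simp) (fun h => by simp [← h] at hi2) (fun h => by simp [← h] at hi2)
    (h0.trans h1.symm) (h1.trans hti.symm)
  exact hft y hy

theorem exists_phases (lab : Fin (4 * m + 1) → ℤ) :
    ∃ s t, ReachesIn lab (unheld m) (allAtOrigin _) s ∧ FinalIn lab (unheld m) s ∧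
      Reaches lab s t ∧ Final lab t := by
  obtain ⟨s, hs, hf⟩ := exists_final lab (unheld m) (x := allAtOrigin _) .refl
  obtain ⟨t, ht, hft⟩ := exists_final lab Set.univ (x := s)
    (hs.mono (fun _ _ => id) (Set.subset_univ _))
  exact ⟨s, t, hs, hf, ht, hft⟩

theorem doubleLabel_le_of_distinctLabel_le (a b : Fin (4 * m + 1))
    (h : distinctLabel (4 * m + 1) a ≤ distinctLabel (4 * m + 1) b) :
    doubleLabel m a ≤ doubleLabel m b := by
  refine doubleLabel_mono (Fin.le_def.mpr ?_)
  unfold distinctLabel at h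
  omega

end Double

end SelfLoopChips

theorem mainTheorem8 (m : ℕ) (hn : 1 < 4 * m + 1) :
    -- with the labels `1, …, n`, some firing sequence ends in a configuration that is not
    -- weakly sorted
    (∃ t : SelfLoopChips.Config (4 * m + 1),
      SelfLoopChips.Reaches (SelfLoopChips.distinctLabel (4 * m + 1))
        (SelfLoopChips.allAtOrigin (4 * m + 1)) t ∧
      SelfLoopChips.Final (SelfLoopChips.distinctLabel (4 * m + 1)) t ∧
      ¬ SelfLoopChips.WeaklySorted (SelfLoopChips.distinctLabel (4 * m + 1)) t) ∧
    -- with the labels `-m, -m, …, m, m`, the same, by a sequence that first fires the chips not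
    -- labeled `-m` for as long as possible and then runs to completion
    (∃ s t : SelfLoopChips.Config (4 * m + 1),
      SelfLoopChips.ReachesIn (SelfLoopChips.doubleLabel m) (SelfLoopChips.unheld m)
        (SelfLoopChips.allAtOrigin (4 * m + 1)) s ∧
      SelfLoopChips.FinalIn (SelfLoopChips.doubleLabel m) (SelfLoopChips.unheld m) s ∧
      SelfLoopChips.Reaches (SelfLoopChips.doubleLabel m) s t ∧
      SelfLoopChips.Final (SelfLoopChips.doubleLabel m) t ∧
      ¬ SelfLoopChips.WeaklySorted (SelfLoopChips.doubleLabel m) t) ∧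
    -- whatever moves are chosen in it, the first phase sorts the chips it uses, and every
    -- completion of it ends in a configuration that is not weakly sorted
    (∀ s : SelfLoopChips.Config (4 * m + 1),
      SelfLoopChips.ReachesIn (SelfLoopChips.doubleLabel m) (SelfLoopChips.unheld m)
        (SelfLoopChips.allAtOrigin (4 * m + 1)) s →
      SelfLoopChips.FinalIn (SelfLoopChips.doubleLabel m) (SelfLoopChips.unheld m) s →
      SelfLoopChips.WeaklySortedOn (SelfLoopChips.doubleLabel m) (SelfLoopChips.unheld m) s ∧
      ∀ t : SelfLoopChips.Config (4 * m + 1),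
        SelfLoopChips.Reaches (SelfLoopChips.doubleLabel m) s t →
        SelfLoopChips.Final (SelfLoopChips.doubleLabel m) t →
        ¬ SelfLoopChips.WeaklySorted (SelfLoopChips.doubleLabel m) t) := by
  have hm : 1 ≤ m := by omega
  refine ⟨?_, ?_, ?_⟩
  · obtain ⟨s, t, hs, hf, ht, hft⟩ := SelfLoopChips.exists_phases
      (SelfLoopChips.distinctLabel (4 * m + 1))
    -- Distinct labels refine the doubled ones: their moves are legal for the doubled labels, and a
    -- sorted configuration stays sorted after the coarsening.
    have hl := SelfLoopChips.doubleLabel_le_of_distinctLabel_le (m := m)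
    refine ⟨t, (hs.mono (fun _ _ => id) (Set.subset_univ _)).trans ht, hft, fun hsort => ?_⟩
    refine SelfLoopChips.not_weaklySorted_of_final hm (hs.mono hl subset_rfl) (hf.congr _)
      (ht.mono hl subset_rfl) (hft.congr _) fun a ha b hb hab => hsort a ha b hb ?_
    by_contra hcon
    exact absurd (hl b a (not_lt.mp hcon)) (not_le.mpr hab)
  · obtain ⟨s, t, hs, hf, ht, hft⟩ := SelfLoopChips.exists_phases (SelfLoopChips.doubleLabel m)
    exact ⟨s, t, hs, hf, ht, hft, SelfLoopChips.not_weaklySorted_of_final hm hs hf ht hft⟩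
  · intro s hs hf
    exact ⟨SelfLoopChips.weaklySortedOn_of_final hm hs hf, fun t ht hft =>
      SelfLoopChips.not_weaklySorted_of_final hm hs hf ht hft⟩
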